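/- Let $R=\bigoplus_{n\in\mathbb Z}R_n$ be a $\mathbb Z$-graded ring that is right artinian and basic, i.e. $R/\operatorname{rad}R$ is a finite direct product of division rings, and let $N$ be a finitely generated right $R$-module. Let $pN=\bigoplus_{n\in\mathbb Z}Ne_n$ be the pull-up of $N$, where each $Ne_n$ is a copy of the abelian group $N$ and $(me_n)r=(mr)e_{n+j}$ for $m\in N$, $r\in R_j$; let $P_N$ be the quotient of $pN$ by the $R$-submodule generated by $\bigoplus_{i<0}Ne_i$. If $N\neq 0$, then $P_N$ is a Prüfer module, i.e. it has a locally nilpotent surjective endomorphism whose kernel is nonzero and of finite length. Moreover, $P_N$ has finite type (that is, it is isomorphic to a direct summand of a direct sum of copies of some right $R$-module of finite length) if and only if $N$ is gradable (that is, $N$ is isomorphic as an $R$-module to a right $R$-module $M=\bigoplus_{n\in\mathbb Z}M_n$ with $M_iR_j\subseteq M_{i+j}$ for all $i,j$). -/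

import Mathlib

universe u v

open MulOpposite

/-!
Right `R`-modules are modules over the opposite ring `Rᵐᵒᵖ`; `op r • m` is the product `m r`.
-/

namespace GradedRight

section General

/-- A module `M` has finite type if it belongs to `Add(X)` for some finite length module `X`,
i.e. it is isomorphic to a direct summand of a direct sum `X^(ι)` of copies of `X`. -/
def HasFiniteType (S : Type u) [Ring S] (M : Type v) [AddCommGroup M] [Module S M] : Prop :=
  ∃ (X : Type (max u v)) (_ : AddCommGroup X) (_ : Module S X), IsFiniteLength S X ∧
    ∃ (ι : Type (max u v)) (A B : Submodule S (ι →₀ X)), IsCompl A B ∧ Nonempty (M ≃ₗ[S] A)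

/-- `P` is a Prüfer module if it has a locally nilpotent, surjective endomorphism whose kernel is
nonzero and of finite length. -/
def IsPruferModule (S : Type u) [Ring S] (P : Type v) [AddCommGroup P] [Module S P] : Prop :=
  ∃ φ : Module.End S P, (∀ x, ∃ n : ℕ, (φ ^ n) x = 0) ∧ Function.Surjective φ ∧
    LinearMap.ker φ ≠ ⊥ ∧ IsFiniteLength S (LinearMap.ker φ)

/-- `R` is basic if `R` modulo its Jacobson radical is a finite direct product of
division rings. -/
def IsBasic (R : Type u) [Ring R] : Prop :=
  ∃ (n : ℕ) (D : Fin n → Type u) (_ : ∀ i, DivisionRing (D i)),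
    Nonempty ((R ⧸ Ring.jacobson R) ≃+* ((i : Fin n) → D i))

end General

section Graded

variable {R : Type u} [Ring R] (𝒜 : ℤ → AddSubgroup R)

/-- `𝓜` is a grading of the right `R`-module `M`: `M = ⨁ 𝓜 i` and `𝓜 i * 𝒜 j ⊆ 𝓜 (i + j)`. -/
structure IsModuleGrading {M : Type v} [AddCommGroup M] [Module Rᵐᵒᵖ M]
    (𝓜 : ℤ → AddSubgroup M) : Prop where
  isInternal : DirectSum.IsInternal 𝓜
  smul_mem : ∀ ⦃i j : ℤ⦄ ⦃m : M⦄ ⦃r : R⦄, m ∈ 𝓜 i → r ∈ 𝒜 j → op r • m ∈ 𝓜 (i + j)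

/-- A right `R`-module is gradable if it is isomorphic to the underlying module of a graded
right `R`-module. -/
def IsGradable (N : Type v) [AddCommGroup N] [Module Rᵐᵒᵖ N] : Prop :=
  ∃ (M : Type v) (_ : AddCommGroup M) (_ : Module Rᵐᵒᵖ M) (𝓜 : ℤ → AddSubgroup M),
    IsModuleGrading 𝒜 𝓜 ∧ Nonempty (N ≃ₗ[Rᵐᵒᵖ] M)

/-- The additive group of the pull-up `pM = ⨁ n, M eₙ`; the element `m eₙ` is `PullUp.e 𝒜 n m`. -/
def PullUp (_ : ℤ → AddSubgroup R) (M : Type v) [AddCommGroup M] [Module Rᵐᵒᵖ M] : Type v :=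
  ℤ →₀ M

namespace PullUp

variable (M : Type v) [AddCommGroup M] [Module Rᵐᵒᵖ M]

noncomputable instance : AddCommGroup (PullUp 𝒜 M) := inferInstanceAs (AddCommGroup (ℤ →₀ M))

variable {M} in
/-- The inclusion `m ↦ m eₙ` of the `n`-th summand. -/
noncomputable def e (n : ℤ) : M →+ PullUp 𝒜 M := Finsupp.singleAddHom n

variable {𝒜 M} in
theorem hom_ext {G : Type*} [AddCommMonoid G] {f g : PullUp 𝒜 M →+ G}
    (h : ∀ n m, f (e 𝒜 n m) = g (e 𝒜 n m)) : f = g :=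
  Finsupp.addHom_ext (f := f) (g := g) h

variable {𝒜 M} in
/-- The additive map out of `pM` with prescribed restrictions to the summands. -/
noncomputable def desc {G : Type*} [AddCommGroup G] (f : ℤ → M →+ G) : PullUp 𝒜 M →+ G :=
  Finsupp.liftAddHom (M := M) f

variable {𝒜 M} in
theorem desc_e {G : Type*} [AddCommGroup G] (f : ℤ → M →+ G) (n : ℤ) (m : M) :
    desc f (e 𝒜 n m) = f n m :=
  Finsupp.liftAddHom_apply_single (M := M) f n m

/-- The action of an element of degree `j`: `m eₙ ↦ (m r) eₙ₊ⱼ`. -/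
noncomputable def homogeneousAct (j : ℤ) : R →+ (PullUp 𝒜 M →+ PullUp 𝒜 M) where
  toFun r := desc fun n => (e 𝒜 (n + j)).comp (DistribSMul.toAddMonoidHom M (op r))
  map_zero' := hom_ext fun n m => by
    rw [desc_e]; simp
  map_add' r s := hom_ext fun n m => by
    rw [AddMonoidHom.add_apply, desc_e, desc_e, desc_e]; simp [add_smul]

theorem homogeneousAct_e (j n : ℤ) (r : R) (m : M) :
    homogeneousAct 𝒜 M j r (e 𝒜 n m) = e 𝒜 (n + j) (op r • m) :=
  desc_e _ n m

variable [GradedRing 𝒜]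

/-- The action of `r = ∑ rⱼ`, obtained from its homogeneous components by linearity. -/
noncomputable def act : R →+ (PullUp 𝒜 M →+ PullUp 𝒜 M) :=
  (DirectSum.toAddMonoid fun j => (homogeneousAct 𝒜 M j).comp (𝒜 j).subtype).comp
    (DirectSum.decomposeAddEquiv 𝒜).toAddMonoidHom

theorem act_e {j : ℤ} {r : R} (hr : r ∈ 𝒜 j) (n : ℤ) (m : M) :
    act 𝒜 M r (e 𝒜 n m) = e 𝒜 (n + j) (op r • m) := by
  have : act 𝒜 M r = homogeneousAct 𝒜 M j r := by
    simp [act, DirectSum.decompose_of_mem 𝒜 hr]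
  rw [this, homogeneousAct_e]

theorem act_one : act 𝒜 M 1 = AddMonoidHom.id _ := hom_ext fun n m => by
  rw [act_e 𝒜 M (SetLike.GradedOne.one_mem (A := 𝒜))]; simp

theorem act_mul (r s : R) : act 𝒜 M (r * s) = (act 𝒜 M s).comp (act 𝒜 M r) := by
  induction r using DirectSum.Decomposition.inductionOn 𝒜 with
  | zero => simp
  | add a b ha hb => rw [add_mul, map_add, ha, hb, map_add, AddMonoidHom.comp_add]
  | @homogeneous i a =>
    induction s using DirectSum.Decomposition.inductionOn 𝒜 with
    | zero => simp
    | add c d hc hd => rw [mul_add, map_add, hc, hd, map_add, AddMonoidHom.add_comp]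
    | @homogeneous j b =>
      refine hom_ext fun n m => ?_
      rw [AddMonoidHom.comp_apply, act_e 𝒜 M a.2, act_e 𝒜 M b.2,
        act_e 𝒜 M (SetLike.mul_mem_graded a.2 b.2), op_mul, mul_smul, add_assoc]

/-- The right `R`-module structure of the pull-up. -/
noncomputable instance : Module Rᵐᵒᵖ (PullUp 𝒜 M) where
  smul r x := act 𝒜 M r.unop x
  one_smul x := by
    change act 𝒜 M 1 x = x
    rw [act_one]; rfl
  mul_smul r s x := by
    change act 𝒜 M (s.unop * r.unop) x = act 𝒜 M r.unop (act 𝒜 M s.unop x)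
    rw [act_mul]; rfl
  smul_zero r := map_zero (act 𝒜 M r.unop)
  smul_add r := map_add (act 𝒜 M r.unop)
  add_smul r s x := by
    change act 𝒜 M (r.unop + s.unop) x = act 𝒜 M r.unop x + act 𝒜 M s.unop x
    rw [map_add]; rfl
  zero_smul x := by
    change act 𝒜 M 0 x = 0
    rw [map_zero]; rfl

/-- `(m eₙ) r = (m r) eₙ₊ⱼ` for `r` of degree `j`. -/
theorem op_smul_e {j : ℤ} {r : R} (hr : r ∈ 𝒜 j) (n : ℤ) (m : M) :
    op r • e 𝒜 n m = e 𝒜 (n + j) (op r • m) :=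
  act_e 𝒜 M hr n m

/-- The submodule of `pM` generated by `⨁ i < 0, M eᵢ`. -/
noncomputable def negativePart : Submodule Rᵐᵒᵖ (PullUp 𝒜 M) :=
  Submodule.span Rᵐᵒᵖ {x | ∃ i : ℤ, i < 0 ∧ ∃ m : M, x = e 𝒜 i m}

end PullUp

/-- `P_M`: the quotient of `pM` by the submodule generated by `⨁ i < 0, M eᵢ`. -/
abbrev PruferQuotient [GradedRing 𝒜] (M : Type v) [AddCommGroup M] [Module Rᵐᵒᵖ M] : Type v :=
  PullUp 𝒜 M ⧸ PullUp.negativePart 𝒜 M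

end Graded

end GradedRight

/-! In a right artinian ring a homogeneous element of nonzero degree is nilpotent; basicness puts it
in the radical. Hence `R = R₀ + rad R`, and as the radical is nilpotent, finitely generated modules
are finitely generated over `R₀`. So `R` lives in degrees `|j| < L`, and every finitely generated
graded module has bounded support. The degree `n` component of `P_N` is `N` modulo the products with
ring elements of degree greater than `n`: it is zero for `n < 0` and all of `N` for `n` large. The
shift by `-1` is the Prüfer endomorphism. If `N` is graded, `pN` is a direct sum of shifted copies
of `N`. Truncation kills or cuts only those near degree `0`, so all summands of `P_N` are, up to
shift, retracts of a single submodule of finite length (`hasFiniteType_pruferQuotient`). Conversely,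
let `P_N` be a retract of `X^(ι)` with `X` of length `ℓ`. In a high degree `n`, Fitting's lemma
yields an indecomposable graded summand `K` of `P_N`, of finite length and nonzero in degree `n`. A
graded Harada–Sai lemma lets `K` behave as a module with local endomorphism ring, so `K` embeds in
`X` and has length at most `ℓ`. An indecomposable graded module has no wide gap in its support, so
`K` sits entirely in high degrees, where `P_N` coincides with `pN`. The inclusion and projection
then descend to maps `K → N → K` whose composite has degree zero part the identity, hence is
bijective: `K` is a gradable summand of `N` (`exists_graded_summand`). The complement inherits the
hypothesis, and induction on length finishes. -/

namespace GradedRight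

/-! ### Radical, nilpotent elements and finiteness over a subring. -/

section RingTheory

/-- Left-right symmetry of the radical: a left inverse `z` of `1 + y` equals `1 - z * y`, so it is
left invertible too, and `1 + y` is a two-sided unit. -/
theorem op_mem_jacobson {R : Type u} [Ring R] {x : R} (hx : x ∈ Ring.jacobson R) :
    op x ∈ Ring.jacobson Rᵐᵒᵖ := by
  have hleft : ∀ y ∈ Ring.jacobson R, ∃ z, z * (1 + y) = 1 := fun y hy => by
    rw [← Ideal.jacobson_bot, Ideal.mem_jacobson_iff] at hy
    obtain ⟨z, hz⟩ := hy 1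
    refine ⟨z, ?_⟩
    rw [Ideal.mem_bot, sub_eq_zero] at hz
    rwa [mul_one, add_comm, ← mul_one_add] at hz
  have hunit : ∀ y ∈ Ring.jacobson R, ∃ z, (1 + y) * z = 1 := fun y hy => by
    obtain ⟨z, hz⟩ := hleft y hy
    obtain ⟨w, hw⟩ := hleft (-(z * y)) (neg_mem (Ideal.mul_mem_left _ z hy))
    have h1 : 1 + -(z * y) = z := by rw [← hz]; noncomm_ring
    rw [h1] at hw
    have h2 : w = 1 + y := by
      calc w = w * (z * (1 + y)) := by rw [hz, mul_one]
        _ = 1 + y := by rw [← mul_assoc, hw, one_mul]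
    exact ⟨z, h2 ▸ hw⟩
  rw [← Ideal.jacobson_bot, Ideal.mem_jacobson_iff]
  intro y
  obtain ⟨z, hz⟩ := hunit _ (Ideal.mul_mem_right y.unop _ hx)
  refine ⟨op z, ?_⟩
  rw [Ideal.mem_bot, sub_eq_zero, ← unop_inj]
  simp only [unop_add, unop_mul, unop_op, unop_one]
  rw [← hz]; noncomm_ring

/-- A product of division rings is reduced. This is all that basicness contributes. -/
theorem IsBasic.mem_jacobson_of_isNilpotent {R : Type u} [Ring R] (h : IsBasic R) {x : R}
    (hx : IsNilpotent x) : x ∈ Ring.jacobson R := by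
  obtain ⟨n, D, hD, ⟨f⟩⟩ := h
  rw [← Ideal.Quotient.eq_zero_iff_mem]
  apply f.injective
  rw [map_zero]
  exact ((hx.map (Ideal.Quotient.mk (Ring.jacobson R))).map f).eq_zero

variable {S : Type*} [Ring S]

/-- If `S = S₀ + J` with `J` nilpotent then Noetherian `S`-modules are finite over `S₀`. -/
theorem fg_restrictScalars_of_isNilpotent (S₀ : Subring S) {J : Ideal S} [J.IsTwoSided]
    (hJ : IsNilpotent J)
    (hS : ∀ s, ∃ s₀ ∈ S₀, s - s₀ ∈ J) {M : Type*} [AddCommGroup M] [Module S M]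
    [IsNoetherian S M] (Q : Submodule S M) : (Q.restrictScalars S₀).FG := by
  obtain ⟨k, hk⟩ := hJ
  -- Induction on the power killing `Q`: generators over `S` generate `Q` over `S₀` modulo `J • Q`,
  -- which a smaller power kills.
  have key : ∀ (k : ℕ) (Q : Submodule S M), J ^ k • Q = ⊥ → (Q.restrictScalars S₀).FG := by
    intro k
    induction k with
    | zero =>
      intro Q hQ
      have : Q = ⊥ := by
        rwa [J.pow_zero, Ideal.one_eq_top, Submodule.top_smul] at hQ
      rw [this, Submodule.restrictScalars_bot]
      exact Submodule.fg_bot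
    | succ k ih =>
      intro Q hQ
      have h1 := ih (J • Q) (by rwa [J.pow_succ, Submodule.mul_smul] at hQ)
      obtain ⟨T, hT⟩ := IsNoetherian.noetherian Q
      have h2 : Q.restrictScalars S₀ ≤
          Submodule.span S₀ (T : Set M) ⊔ (J • Q).restrictScalars S₀ := by
        have hle1 : Submodule.span S₀ (T : Set M) ≤
          Submodule.span S₀ (T : Set M) ⊔ (J • Q).restrictScalars S₀ := le_sup_left
        have hle2 : (J • Q).restrictScalars S₀ ≤
          Submodule.span S₀ (T : Set M) ⊔ (J • Q).restrictScalars S₀ := le_sup_right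
        generalize Submodule.span S₀ (T : Set M) ⊔ (J • Q).restrictScalars S₀ = W at hle1 hle2
        intro x hx
        rw [Submodule.restrictScalars_mem, ← hT] at hx
        induction hx using Submodule.span_induction with
        | mem x h => exact hle1 (Submodule.subset_span h)
        | zero => exact zero_mem _
        | add x y _ _ hx hy => exact add_mem hx hy
        | smul s x hx' hx =>
          rw [hT] at hx'
          obtain ⟨s₀, hs₀, hs⟩ := hS s
          have h3 : s • x = (⟨s₀, hs₀⟩ : S₀) • x + (s - s₀) • x := by
            change s • x = s₀ • x + (s - s₀) • x
            rw [sub_smul]; abel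
          have h4 : (s - s₀) • x ∈ J • Q := Submodule.smul_mem_smul hs hx'
          rw [h3]
          exact W.add_mem (W.smul_mem _ hx) (hle2 h4)
      have h5 : Submodule.span S₀ (T : Set M) ≤ Q.restrictScalars S₀ := by
        rw [Submodule.span_le]
        intro x hx
        change x ∈ Q
        rw [← hT]; exact Submodule.subset_span hx
      have h6 : (J • Q).restrictScalars S₀ ≤ Q.restrictScalars S₀ := fun x hx =>
        Submodule.smul_le_right (I := J) (N := Q) hx
      rw [le_antisymm h2 (sup_le h5 h6)]
      exact Submodule.FG.sup ⟨T, rfl⟩ h1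
  exact key k Q (by rw [hk]; simp)

end RingTheory

/-! ### Consequences of the artinian and basic hypotheses for the grading of the ring. -/

section GradedRing

variable {R : Type u} [Ring R] (𝒜 : ℤ → AddSubgroup R) [GradedRing 𝒜]

theorem proj_mul_of_left_mem {n : ℤ} {x : R} (hx : x ∈ 𝒜 n) (r : R) (m : ℤ) :
    GradedRing.proj 𝒜 m (x * r) = x * GradedRing.proj 𝒜 (m - n) r := by
  rw [GradedRing.proj_apply, GradedRing.proj_apply,
    ← DirectSum.coe_decompose_mul_add_of_left_mem 𝒜 hx, add_sub_cancel]

theorem proj_mul_of_right_mem_zero {x : R} (hx : x ∈ 𝒜 0) (r : R) (m : ℤ) :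
    GradedRing.proj 𝒜 m (r * x) = GradedRing.proj 𝒜 m r * x := by
  rw [GradedRing.proj_apply, GradedRing.proj_apply,
    DirectSum.coe_decompose_mul_of_right_mem_zero 𝒜 hx]

theorem finite_setOf_proj_ne_zero (r : R) : {m | GradedRing.proj 𝒜 m r ≠ 0}.Finite := by
  classical
  refine (DirectSum.decompose 𝒜 r).support.finite_toSet.subset fun m hm => ?_
  rw [Finset.mem_coe, GradedRing.mem_support_iff]
  exact hm

/-- If `R` is right artinian, homogeneous elements of nonzero degree are nilpotent. -/
theorem isNilpotent_of_mem (hart : IsArtinianRing Rᵐᵒᵖ) {n : ℤ} (hn : n ≠ 0) {x : R}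
    (hx : x ∈ 𝒜 n) : IsNilpotent x := by
  have hfin : ∀ (r : R) (m : ℤ) (k : ℤ), k ≠ 0 →
      ∃ j : ℕ, GradedRing.proj 𝒜 (m + j * k) r = 0 := fun r m k hk => by
    have h1 : Set.InjOn (fun j : ℕ => m + j * k) Set.univ := fun i _ j _ h => by
      simpa [hk] using h
    obtain ⟨j, hj⟩ := (Set.Finite.preimage (h1.mono (Set.subset_univ _))
      (finite_setOf_proj_ne_zero 𝒜 r)).exists_notMem
    exact ⟨j, by simpa using hj⟩
  -- Left multiplication by `1 - x` is injective: `s = x * s` writes each component of `s` as `x ^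
  -- j` times a component arbitrarily far away, hence zero.
  have hinj : Function.Injective (LinearMap.toSpanSingleton Rᵐᵒᵖ Rᵐᵒᵖ (op (1 - x))) := by
    rw [injective_iff_map_eq_zero]
    intro s hs
    have h1 : s.unop = x * s.unop := by
      have := congrArg unop hs
      simp only [LinearMap.toSpanSingleton_apply, smul_eq_mul, unop_mul, unop_op, unop_zero,
        sub_mul, one_mul] at this
      exact sub_eq_zero.mp this
    have h2 : ∀ (j : ℕ) (m : ℤ), GradedRing.proj 𝒜 m s.unop =
        x ^ j * GradedRing.proj 𝒜 (m + j * -n) s.unop := by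
      intro j
      induction j with
      | zero => simp
      | succ j ih =>
        intro m
        have h3 : m + j * -n - n = m + (j + 1 : ℕ) * -n := by push_cast; ring
        rw [ih m, h1, proj_mul_of_left_mem 𝒜 hx, ← h1, h3, ← mul_assoc, ← pow_succ]
    have h3 : s.unop = 0 := by
      apply (DirectSum.decompose 𝒜).injective
      ext m
      obtain ⟨j, hj⟩ := hfin s.unop m (-n) (neg_ne_zero.mpr hn)
      rw [← GradedRing.proj_apply, h2 j m, hj]; simp
    exact unop_injective h3
  -- The right inverse of `1 - x` must be the geometric series: its component of degree `j * n` is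
  -- `x ^ j`, and almost all components vanish.
  obtain ⟨s, hs⟩ := IsArtinian.surjective_of_injective_endomorphism _ hinj 1
  have h1 : s.unop = 1 + x * s.unop := by
    have := congrArg unop hs
    simp only [LinearMap.toSpanSingleton_apply, smul_eq_mul, unop_mul, unop_op, unop_one,
      sub_mul, one_mul] at this
    rw [← this]; abel
  have hrec : ∀ m : ℤ, m ≠ 0 → GradedRing.proj 𝒜 m s.unop =
      x * GradedRing.proj 𝒜 (m - n) s.unop := fun m hm => by
    conv_lhs => rw [h1]
    rw [map_add, proj_mul_of_left_mem 𝒜 hx, GradedRing.proj_apply,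
      DirectSum.decompose_of_mem_ne 𝒜 (SetLike.GradedOne.one_mem (A := 𝒜)) hm.symm, zero_add]
  have hsucc : ∀ (j : ℕ) (k : ℤ), k ≠ 0 → ((j + 1 : ℕ) * k : ℤ) ≠ 0 := fun j k hk =>
    mul_ne_zero (by exact_mod_cast j.succ_ne_zero) hk
  -- The recursion `hrec` fails only in degree `0`, which is never met going away from `-n`. So the
  -- component of degree `-n` vanishes, and that of degree `0` is exactly `1`.
  have hneg : ∀ j : ℕ, GradedRing.proj 𝒜 (-n) s.unop =
      x ^ j * GradedRing.proj 𝒜 (-n + j * -n) s.unop := by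
    intro j
    induction j with
    | zero => simp
    | succ j ih =>
      have h2 : -n + j * -n = (j + 1 : ℕ) * -n := by push_cast; ring
      have h3 : (j + 1 : ℕ) * -n - n = -n + (j + 1 : ℕ) * -n := by ring
      rw [ih, h2, hrec _ (hsucc j _ (neg_ne_zero.mpr hn)), h3, ← mul_assoc, ← pow_succ]
  have hneg0 : GradedRing.proj 𝒜 (-n) s.unop = 0 := by
    obtain ⟨j, hj⟩ := hfin s.unop (-n) (-n) (neg_ne_zero.mpr hn)
    rw [hneg j, hj, mul_zero]
  have hpos : ∀ j : ℕ, GradedRing.proj 𝒜 (j * n) s.unop = x ^ j := by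
    intro j
    induction j with
    | zero =>
      rw [h1, Nat.cast_zero, zero_mul, map_add, proj_mul_of_left_mem 𝒜 hx, zero_sub, hneg0,
        mul_zero, add_zero, pow_zero]
      exact DirectSum.decompose_of_mem_same 𝒜 (SetLike.GradedOne.one_mem (A := 𝒜))
    | succ j ih =>
      have h2 : (j + 1 : ℕ) * n - n = j * n := by push_cast; ring
      rw [hrec _ (hsucc j n hn), h2, ih, pow_succ']
  obtain ⟨j, hj⟩ := hfin s.unop 0 n hn
  rw [zero_add] at hj
  exact ⟨j, by rw [← hpos, hj]⟩

/-- Finitely generated right `R`-modules are finitely generated over the degree zero part. -/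
theorem exists_finset_closure_eq_top (hart : IsArtinianRing Rᵐᵒᵖ) (hbasic : IsBasic R)
    (M : Type v) [AddCommGroup M] [Module Rᵐᵒᵖ M] [Module.Finite Rᵐᵒᵖ M] :
    ∃ T : Finset M, ∀ x : M, x ∈ AddSubgroup.closure {y | ∃ t ∈ T, ∃ r ∈ 𝒜 0, y = op r • t} := by
  classical
  let S₀ : Subring Rᵐᵒᵖ := (SetLike.GradeZero.subring 𝒜).op
  -- `R = R₀ + rad R`, since components of nonzero degree are nilpotent.
  have hS : ∀ s : Rᵐᵒᵖ, ∃ s₀ ∈ S₀, s - s₀ ∈ Ring.jacobson Rᵐᵒᵖ := by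
    intro s
    have : ∀ r : R, ∃ r₀ ∈ 𝒜 0, op r - op r₀ ∈ Ring.jacobson Rᵐᵒᵖ := by
      intro r
      induction r using DirectSum.Decomposition.inductionOn 𝒜 with
      | zero => exact ⟨0, zero_mem _, by simp⟩
      | add a b ha hb =>
        obtain ⟨a', ha', ha⟩ := ha
        obtain ⟨b', hb', hb⟩ := hb
        refine ⟨a' + b', add_mem ha' hb', ?_⟩
        have := add_mem ha hb
        rw [op_add, op_add]
        convert this using 1
        abel
      | @homogeneous i a =>
        by_cases hi : i = 0
        · subst hi; exact ⟨a, a.2, by simp⟩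
        · exact ⟨0, zero_mem _, by
            simpa using op_mem_jacobson
              (hbasic.mem_jacobson_of_isNilpotent (isNilpotent_of_mem 𝒜 hart hi a.2))⟩
    obtain ⟨r₀, h, h'⟩ := this s.unop
    exact ⟨op r₀, h, h'⟩
  obtain ⟨T, hT⟩ := fg_restrictScalars_of_isNilpotent S₀ 
    (IsSemiprimaryRing.isNilpotent (R := Rᵐᵒᵖ)) hS (⊤ : Submodule Rᵐᵒᵖ M)
  refine ⟨T, fun x => ?_⟩
  have hx : x ∈ Submodule.span S₀ (T : Set M) := by rw [hT]; trivial
  refine Submodule.span_induction (fun t ht => ?_) (zero_mem _)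
    (fun _ _ _ _ h h' => add_mem h h') (fun s x _ hx => ?_) hx
  · exact AddSubgroup.subset_closure ⟨t, ht, 1, SetLike.GradedOne.one_mem (A := 𝒜), by simp⟩
  · refine AddSubgroup.closure_induction (fun y hy => ?_) ?_ (fun a b _ _ ha hb => ?_)
      (fun a _ ha => ?_) hx
    · obtain ⟨t, ht, r, hr, rfl⟩ := hy
      refine AddSubgroup.subset_closure ⟨t, ht, r * unop s.1, ?_, ?_⟩
      · have := SetLike.mul_mem_graded hr (show unop s.1 ∈ 𝒜 0 from s.2)
        simpa using this
      · rw [op_mul, op_unop, mul_smul]; rfl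
    · rw [smul_zero]; exact zero_mem _
    · rw [smul_add]; exact add_mem ha hb
    · rw [smul_neg]; exact neg_mem ha

/-- Right multiplication by `R₀` preserves degrees, so only degrees in the supports of finitely many
`R₀`-generators of `R` occur. -/
theorem exists_bound (hart : IsArtinianRing Rᵐᵒᵖ) (hbasic : IsBasic R) :
    ∃ L : ℤ, 0 < L ∧ ∀ j : ℤ, L ≤ |j| → ∀ r ∈ 𝒜 j, r = 0 := by
  classical
  obtain ⟨T, hT⟩ := exists_finset_closure_eq_top 𝒜 hart hbasic Rᵐᵒᵖ
  let F : Finset ℤ := T.biUnion fun t => (finite_setOf_proj_ne_zero 𝒜 t.unop).toFinset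
  have hF : ∀ x : R, ∀ m ∉ F, GradedRing.proj 𝒜 m x = 0 := by
    intro x m hm
    suffices h : ∀ y ∈ AddSubgroup.closure {y | ∃ t ∈ T, ∃ r ∈ 𝒜 0, y = op r • t},
        GradedRing.proj 𝒜 m y.unop = 0 from h _ (hT (op x))
    intro y hy
    refine AddSubgroup.closure_induction (fun y hy => ?_) ?_ (fun a b _ _ ha hb => ?_)
      (fun a _ ha => ?_) hy
    · obtain ⟨t, ht, r, hr, rfl⟩ := hy
      have h1 : GradedRing.proj 𝒜 m t.unop = 0 := by
        by_contra h
        exact hm (Finset.mem_biUnion.mpr ⟨t, ht, by simpa using h⟩)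
      rw [smul_eq_mul, unop_mul, unop_op, proj_mul_of_right_mem_zero 𝒜 hr, h1, zero_mul]
    · exact map_zero _
    · rw [unop_add, map_add, ha, hb, add_zero]
    · rw [unop_neg, map_neg, ha, neg_zero]
  refine ⟨1 + ∑ i ∈ F, |i|, by have := Finset.sum_nonneg (s := F) fun i _ => abs_nonneg i; omega,
    fun j hj r hr => ?_⟩
  rw [← DirectSum.decompose_of_mem_same 𝒜 hr]
  refine hF r j fun h => ?_
  have := Finset.single_le_sum (f := fun i : ℤ => |i|) (fun i _ => abs_nonneg i) h
  omega

end GradedRing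

/-! ### Coefficients, universal property and functoriality of the pull-up. -/

namespace PullUp

variable {R : Type u} [Ring R] {𝒜 : ℤ → AddSubgroup R}
variable {M : Type*} [AddCommGroup M] [Module Rᵐᵒᵖ M]

theorem induction_on {p : PullUp 𝒜 M → Prop} (x : PullUp 𝒜 M) (zero : p 0)
    (add : ∀ x y, p x → p y → p (x + y)) (single : ∀ n m, p (e 𝒜 n m)) : p x :=
  Finsupp.induction_linear (motive := p) x zero (fun x y => add x y) single

/-- The coefficient of `eₙ`. -/
noncomputable def coeff (n : ℤ) : PullUp 𝒜 M →+ M := Finsupp.applyAddHom n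

theorem coeff_e (n k : ℤ) (m : M) : coeff n (e 𝒜 k m) = if k = n then m else 0 :=
  Finsupp.single_apply

@[simp]
theorem coeff_e_same (n : ℤ) (m : M) : coeff n (e 𝒜 n m) = m := by simp [coeff_e]

theorem coeff_e_of_ne {n k : ℤ} (h : k ≠ n) (m : M) : coeff n (e 𝒜 k m) = 0 := by
  simp [coeff_e, h]

theorem ext_coeff {x y : PullUp 𝒜 M} (h : ∀ n, coeff n x = coeff n y) : x = y :=
  Finsupp.ext (f := x) (g := y) h

theorem finite_coeff_ne_zero (x : PullUp 𝒜 M) : {n | coeff n x ≠ 0}.Finite :=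
  Finsupp.hasFiniteSupport (α := ℤ) (M := M) x

theorem eq_sum {x : PullUp 𝒜 M} {s : Finset ℤ} (hs : ∀ n ∉ s, coeff n x = 0) :
    x = ∑ n ∈ s, e 𝒜 n (coeff n x) := by
  refine ext_coeff fun k => ?_
  rw [map_sum]
  simp only [coeff_e, Finset.sum_ite_eq']
  split_ifs with h
  · rfl
  · exact hs k h

variable [GradedRing 𝒜]
variable {G : Type*} [AddCommGroup G] [Module Rᵐᵒᵖ G]

theorem map_op_smul_of_e {f : PullUp 𝒜 M →+ G}
    (h : ∀ ⦃j : ℤ⦄ ⦃r : R⦄, r ∈ 𝒜 j → ∀ n m, f (e 𝒜 (n + j) (op r • m)) = op r • f (e 𝒜 n m))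
    (s : Rᵐᵒᵖ) (x : PullUp 𝒜 M) : f (s • x) = s • f x := by
  obtain ⟨r, rfl⟩ := op_surjective s
  induction r using DirectSum.Decomposition.inductionOn 𝒜 with
  | zero => simp
  | add a b ha hb => rw [op_add, add_smul, map_add, ha, hb, add_smul]
  | @homogeneous i a =>
    induction x using induction_on with
    | zero => simp
    | add x y hx hy => rw [smul_add, map_add, hx, hy, map_add, smul_add]
    | single n m => rw [op_smul_e 𝒜 M a.2, h a.2]

/-- The linear map out of the pull-up with prescribed restrictions to the summands. -/
noncomputable def lift (f : ℤ → M →+ G)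
    (h : ∀ ⦃j : ℤ⦄ ⦃r : R⦄, r ∈ 𝒜 j → ∀ n m, f (n + j) (op r • m) = op r • f n m) :
    PullUp 𝒜 M →ₗ[Rᵐᵒᵖ] G where
  toFun := desc f
  map_add' := map_add _
  map_smul' := map_op_smul_of_e fun j r hr n m => by rw [desc_e, desc_e, h hr]

@[simp]
theorem lift_e (f : ℤ → M →+ G)
    (h : ∀ ⦃j : ℤ⦄ ⦃r : R⦄, r ∈ 𝒜 j → ∀ n m, f (n + j) (op r • m) = op r • f n m) (n : ℤ) (m : M) :
    lift f h (e 𝒜 n m) = f n m :=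
  desc_e f n m

theorem coeff_op_smul {j : ℤ} {r : R} (hr : r ∈ 𝒜 j) (n : ℤ) (x : PullUp 𝒜 M) :
    coeff (n + j) (op r • x) = op r • coeff n x := by
  induction x using induction_on with
  | zero => simp
  | add x y hx hy => rw [smul_add, map_add, hx, hy, map_add, smul_add]
  | single k m =>
    rw [op_smul_e 𝒜 M hr, coeff_e, coeff_e]
    by_cases h : k = n <;> simp [h]

section Maps

variable {M' : Type*} [AddCommGroup M'] [Module Rᵐᵒᵖ M']

/-- Functoriality of the pull-up. -/
noncomputable def map (f : M →ₗ[Rᵐᵒᵖ] M') : PullUp 𝒜 M →ₗ[Rᵐᵒᵖ] PullUp 𝒜 M' :=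
  lift (fun n => (e 𝒜 n).comp f.toAddMonoidHom) fun j r hr n m => by
    simp [op_smul_e 𝒜 M' hr]

@[simp]
theorem map_e (f : M →ₗ[Rᵐᵒᵖ] M') (n : ℤ) (m : M) : map f (e 𝒜 n m) = e 𝒜 n (f m) := by
  simp [map]

@[simp]
theorem coeff_map (f : M →ₗ[Rᵐᵒᵖ] M') (n : ℤ) (x : PullUp 𝒜 M) :
    coeff n (map f x) = f (coeff n x) := by
  induction x using induction_on with
  | zero => simp
  | add x y hx hy => simp [hx, hy]
  | single k m => rw [map_e, coeff_e, coeff_e]; split_ifs <;> simp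

variable (𝒜 M) in
/-- The shift `m eₙ ↦ m eₙ₊ₖ`. -/
noncomputable def shift (k : ℤ) : PullUp 𝒜 M →ₗ[Rᵐᵒᵖ] PullUp 𝒜 M :=
  lift (fun n => e 𝒜 (n + k)) fun j r hr n m => by
    rw [op_smul_e 𝒜 M hr, add_right_comm]

@[simp]
theorem shift_e (k n : ℤ) (m : M) : shift 𝒜 M k (e 𝒜 n m) = e 𝒜 (n + k) m := by
  simp [shift]

variable (𝒜 M) in
/-- The push-down `m eₙ ↦ m`. -/
noncomputable def counit : PullUp 𝒜 M →ₗ[Rᵐᵒᵖ] M :=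
  lift (fun _ => AddMonoidHom.id M) fun j r hr n m => by simp

@[simp]
theorem counit_e (n : ℤ) (m : M) : counit 𝒜 M (e 𝒜 n m) = m := by
  simp [counit]

theorem counit_map (f : M →ₗ[Rᵐᵒᵖ] M') (x : PullUp 𝒜 M) :
    counit 𝒜 M' (map f x) = f (counit 𝒜 M x) := by
  induction x using induction_on with
  | zero => simp
  | add x y hx hy => simp [hx, hy]
  | single n m => simp

end Maps

end PullUp

/-! ### Gradings as coactions, homogeneous maps and graded retracts. -/

open PullUp

/-- A grading of a right module, given by its coaction `x ↦ ∑ xₙ eₙ`. -/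
structure Grading {R : Type u} [Ring R] (𝒜 : ℤ → AddSubgroup R) [GradedRing 𝒜] (M : Type v)
    [AddCommGroup M] [Module Rᵐᵒᵖ M] where
  /-- The map `x ↦ ∑ xₙ eₙ`. -/
  coact : M →ₗ[Rᵐᵒᵖ] PullUp 𝒜 M
  counit_coact : ∀ x, counit 𝒜 M (coact x) = x
  coact_coeff : ∀ n x, coact (coeff n (coact x)) = e 𝒜 n (coeff n (coact x))

namespace Grading

variable {R : Type u} [Ring R] {𝒜 : ℤ → AddSubgroup R} [GradedRing 𝒜]
variable {M : Type*} [AddCommGroup M] [Module Rᵐᵒᵖ M] (𝓖 : Grading 𝒜 M)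
variable {M' : Type*} [AddCommGroup M'] [Module Rᵐᵒᵖ M'] (𝓖' : Grading 𝒜 M')
variable {M'' : Type*} [AddCommGroup M''] [Module Rᵐᵒᵖ M''] (𝓖'' : Grading 𝒜 M'')

/-- The projection onto the component of degree `n`. -/
noncomputable def proj (n : ℤ) : M →+ M := (coeff n).comp 𝓖.coact.toAddMonoidHom

theorem coeff_coact (n : ℤ) (x : M) : coeff n (𝓖.coact x) = 𝓖.proj n x := rfl

theorem coact_proj (n : ℤ) (x : M) : 𝓖.coact (𝓖.proj n x) = e 𝒜 n (𝓖.proj n x) :=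
  𝓖.coact_coeff n x

theorem proj_proj_same (n : ℤ) (x : M) : 𝓖.proj n (𝓖.proj n x) = 𝓖.proj n x := by
  rw [← coeff_coact, coact_proj, coeff_e_same]

theorem proj_proj_of_ne {n k : ℤ} (h : n ≠ k) (x : M) : 𝓖.proj k (𝓖.proj n x) = 0 := by
  rw [← coeff_coact, coact_proj, coeff_e_of_ne h]

theorem finite_proj_ne_zero (x : M) : {n | 𝓖.proj n x ≠ 0}.Finite :=
  finite_coeff_ne_zero (𝓖.coact x)

theorem coact_eq_sum {x : M} {s : Finset ℤ} (hs : ∀ n ∉ s, 𝓖.proj n x = 0) :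
    𝓖.coact x = ∑ n ∈ s, e 𝒜 n (𝓖.proj n x) :=
  eq_sum hs

theorem eq_sum_proj {x : M} {s : Finset ℤ} (hs : ∀ n ∉ s, 𝓖.proj n x = 0) :
    x = ∑ n ∈ s, 𝓖.proj n x := by
  conv_lhs => rw [← 𝓖.counit_coact x, 𝓖.coact_eq_sum hs]
  simp

theorem proj_op_smul {j : ℤ} {r : R} (hr : r ∈ 𝒜 j) (n : ℤ) (x : M) :
    𝓖.proj (n + j) (op r • x) = op r • 𝓖.proj n x := by
  rw [← coeff_coact, map_smul, coeff_op_smul hr, coeff_coact]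

theorem induction_on {p : M → Prop} (x : M) (zero : p 0) (add : ∀ x y, p x → p y → p (x + y))
    (homogeneous : ∀ n x, 𝓖.proj n x = x → p x) : p x := by
  rw [𝓖.eq_sum_proj (x := x) (s := (𝓖.finite_proj_ne_zero x).toFinset) (by simp)]
  exact Finset.sum_induction _ p add zero fun n _ => homogeneous n _ (𝓖.proj_proj_same n x)

theorem ext_proj {x y : M} (h : ∀ n, 𝓖.proj n x = 𝓖.proj n y) : x = y := by
  have : 𝓖.coact x = 𝓖.coact y := ext_coeff h
  rw [← 𝓖.counit_coact x, ← 𝓖.counit_coact y, this]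

/-- The linear map `m eₙ ↦ mₙ`. -/
noncomputable def collapse : PullUp 𝒜 M →ₗ[Rᵐᵒᵖ] M :=
  lift 𝓖.proj fun _ _ hr n m => 𝓖.proj_op_smul hr n m

@[simp]
theorem collapse_e (n : ℤ) (m : M) : 𝓖.collapse (e 𝒜 n m) = 𝓖.proj n m := by
  simp [collapse]

/-- `f` is homogeneous of degree `d`. -/
def IsHomogeneousMap (d : ℤ) (f : M →ₗ[Rᵐᵒᵖ] M') : Prop :=
  ∀ n x, 𝓖'.proj (n + d) (f x) = f (𝓖.proj n x)

variable {𝓖 𝓖' 𝓖''} in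
theorem IsHomogeneousMap.comp {d d' : ℤ} {g : M' →ₗ[Rᵐᵒᵖ] M''} {f : M →ₗ[Rᵐᵒᵖ] M'}
    (hg : IsHomogeneousMap 𝓖' 𝓖'' d' g) (hf : IsHomogeneousMap 𝓖 𝓖' d f) :
    IsHomogeneousMap 𝓖 𝓖'' (d + d') (g ∘ₗ f) := fun n x => by
  rw [LinearMap.comp_apply, ← add_assoc, hg, hf, LinearMap.comp_apply]

variable {𝓖 𝓖' 𝓖''} in
theorem IsHomogeneousMap.comp_zero {g : M' →ₗ[Rᵐᵒᵖ] M''} {f : M →ₗ[Rᵐᵒᵖ] M'}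
    (hg : IsHomogeneousMap 𝓖' 𝓖'' 0 g) (hf : IsHomogeneousMap 𝓖 𝓖' 0 f) :
    IsHomogeneousMap 𝓖 𝓖'' 0 (g ∘ₗ f) := hg.comp hf

variable {𝓖 𝓖'} in
theorem IsHomogeneousMap.proj_apply {f : M →ₗ[Rᵐᵒᵖ] M'} (hf : IsHomogeneousMap 𝓖 𝓖' 0 f)
    (n : ℤ) (x : M) : 𝓖'.proj n (f x) = f (𝓖.proj n x) := by
  have := hf n x
  rwa [add_zero] at this

/-- The component of degree `d` of a linear map between graded modules. -/
noncomputable def part (d : ℤ) (f : M →ₗ[Rᵐᵒᵖ] M') : M →ₗ[Rᵐᵒᵖ] M' :=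
  𝓖'.collapse ∘ₗ shift 𝒜 M' d ∘ₗ map f ∘ₗ 𝓖.coact

theorem part_of_proj_eq {d n : ℤ} (f : M →ₗ[Rᵐᵒᵖ] M') {x : M} (hx : 𝓖.proj n x = x) :
    part 𝓖 𝓖' d f x = 𝓖'.proj (n + d) (f x) := by
  have : 𝓖.coact x = e 𝒜 n x := by rw [← hx, coact_proj]
  simp [part, this]

theorem part_isHomogeneousMap (d : ℤ) (f : M →ₗ[Rᵐᵒᵖ] M') :
    IsHomogeneousMap 𝓖 𝓖' d (part 𝓖 𝓖' d f) := fun n x => by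
  induction x using 𝓖.induction_on with
  | zero => simp
  | add x y hx hy => rw [map_add, map_add, hx, hy, map_add, map_add]
  | homogeneous k x hx =>
    rw [part_of_proj_eq 𝓖 𝓖' f hx]
    by_cases h : k = n
    · subst h
      rw [hx, proj_proj_same, part_of_proj_eq 𝓖 𝓖' f hx]
    · rw [← hx, proj_proj_of_ne 𝓖 h, map_zero, proj_proj_of_ne]
      simpa using h

theorem eq_sum_part {f : M →ₗ[Rᵐᵒᵖ] M'} {s : Finset ℤ}
    (hs : ∀ d ∉ s, ∀ n x, 𝓖'.proj (n + d) (f (𝓖.proj n x)) = 0) :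
    f = ∑ d ∈ s, part 𝓖 𝓖' d f := by
  ext x
  rw [LinearMap.sum_apply]
  induction x using 𝓖.induction_on with
  | zero => simp
  | add x y hx hy => simp_rw [map_add, Finset.sum_add_distrib]; rw [hx, hy]
  | homogeneous n x hx =>
    simp_rw [part_of_proj_eq 𝓖 𝓖' f hx]
    have h1 := 𝓖'.eq_sum_proj (x := f x) (s := s.map (addLeftEmbedding n)) (by
      intro k hk
      have := hs (k - n) (fun h => hk (Finset.mem_map.mpr ⟨_, h, by simp⟩)) n x
      rwa [hx, add_sub_cancel] at this)
    conv_lhs => rw [h1, Finset.sum_map]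
    rfl

/-- A submodule is homogeneous if it is stable under the projections. -/
def IsHomogeneousSubmodule (A : Submodule Rᵐᵒᵖ M) : Prop := ∀ x ∈ A, ∀ n, 𝓖.proj n x ∈ A

variable {𝓖 𝓖'} in
theorem IsHomogeneousMap.ker {d : ℤ} {f : M →ₗ[Rᵐᵒᵖ] M'} (hf : IsHomogeneousMap 𝓖 𝓖' d f) :
    𝓖.IsHomogeneousSubmodule (LinearMap.ker f) := fun x hx n => by
  rw [LinearMap.mem_ker] at hx ⊢
  rw [← hf n x, hx, map_zero]

variable {𝓖 𝓖'} in
theorem IsHomogeneousMap.range {d : ℤ} {f : M →ₗ[Rᵐᵒᵖ] M'} (hf : IsHomogeneousMap 𝓖 𝓖' d f) :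
    𝓖'.IsHomogeneousSubmodule (LinearMap.range f) := by
  rintro _ ⟨x, rfl⟩ n
  refine ⟨𝓖.proj (n - d) x, ?_⟩
  rw [← hf, sub_add_cancel]

/-- The grading of a retract whose idempotent has degree zero. -/
noncomputable def ofRetract {K : Type*} [AddCommGroup K] [Module Rᵐᵒᵖ K] (i : K →ₗ[Rᵐᵒᵖ] M)
    (p : M →ₗ[Rᵐᵒᵖ] K) (hpi : ∀ x, p (i x) = x) (h : IsHomogeneousMap 𝓖 𝓖 0 (i ∘ₗ p)) :
    Grading 𝒜 K where
  coact := map p ∘ₗ 𝓖.coact ∘ₗ i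
  counit_coact x := by
    simp [counit_map, counit_coact, hpi]
  coact_coeff n x := by
    have h1 : i (p (𝓖.proj n (i x))) = 𝓖.proj n (i x) := by
      have := h.proj_apply n (i x)
      simp only [LinearMap.comp_apply, hpi] at this
      exact this.symm
    simp only [LinearMap.comp_apply, coeff_map, coeff_coact, h1, coact_proj, map_e]

section Retract

variable {K : Type*} [AddCommGroup K] [Module Rᵐᵒᵖ K] (i : K →ₗ[Rᵐᵒᵖ] M)
    (p : M →ₗ[Rᵐᵒᵖ] K) (hpi : ∀ x, p (i x) = x) (h : IsHomogeneousMap 𝓖 𝓖 0 (i ∘ₗ p))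

theorem ofRetract_proj (n : ℤ) (x : K) :
    (𝓖.ofRetract i p hpi h).proj n x = p (𝓖.proj n (i x)) := by
  rw [← coeff_coact]
  simp [ofRetract, coeff_coact]

theorem ofRetract_incl : IsHomogeneousMap (𝓖.ofRetract i p hpi h) 𝓖 0 i := fun n x => by
  rw [ofRetract_proj, ← LinearMap.comp_apply, ← h n, LinearMap.comp_apply, hpi]

theorem ofRetract_retr : IsHomogeneousMap 𝓖 (𝓖.ofRetract i p hpi h) 0 p := fun n x => by
  rw [ofRetract_proj, add_zero, ← LinearMap.comp_apply (f := i), h.proj_apply,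
    LinearMap.comp_apply, hpi]

end Retract

theorem isHomogeneousMap_of_isCompl {A B : Submodule Rᵐᵒᵖ M} (hA : 𝓖.IsHomogeneousSubmodule A)
    (hB : 𝓖.IsHomogeneousSubmodule B) (hAB : IsCompl A B) :
    IsHomogeneousMap 𝓖 𝓖 0 (A.subtype ∘ₗ A.projectionOnto B hAB) := fun n x => by
  obtain ⟨a, ha, b, hb, rfl⟩ : ∃ a ∈ A, ∃ b ∈ B, a + b = x :=
    Submodule.mem_sup.mp (hAB.sup_eq_top ▸ Submodule.mem_top)
  have h1 : ∀ a ∈ A, A.projectionOnto B hAB a = a := fun a ha =>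
    congrArg Subtype.val (Submodule.projectionOnto_apply_of_mem_left hAB ha)
  have h2 : ∀ b ∈ B, (A.projectionOnto B hAB b : M) = 0 := fun b hb => by
    rw [(Submodule.projectionOnto_apply_eq_zero_iff hAB).mpr hb]; rfl
  simp only [LinearMap.comp_apply, Submodule.subtype_apply, map_add, h1 a ha,
    h2 b hb, h1 _ (hA a ha n), h2 _ (hB b hb n), add_zero]

end Grading

/-! ### Graded Harada–Sai lemma and endomorphisms of indecomposable graded modules. -/

open scoped Pointwise

section Length

variable {S : Type*} [Ring S] {M : Type*} [AddCommGroup M] [Module S M]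

theorem _root_.Submodule.eq_of_le_of_length_le [IsArtinian S M] [IsNoetherian S M]
    {A B : Submodule S M} (h : A ≤ B) (hl : Module.length S B ≤ Module.length S A) : A = B := by
  by_contra hne
  have := Submodule.height_strictMono (lt_of_le_of_ne h hne)
  rw [← Module.length_submodule, ← Module.length_submodule] at this
  exact absurd hl (not_le.mpr this)

end Length

namespace Grading

variable {R : Type u} [Ring R] {𝒜 : ℤ → AddSubgroup R} [GradedRing 𝒜]
variable {M : Type*} [AddCommGroup M] [Module Rᵐᵒᵖ M] (𝓖 : Grading 𝒜 M)

/-- A graded module is indecomposable if it has no proper homogeneous complemented submodules. -/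
def IsIndecomposable : Prop :=
  ∀ A B : Submodule Rᵐᵒᵖ M, 𝓖.IsHomogeneousSubmodule A → 𝓖.IsHomogeneousSubmodule B →
    IsCompl A B → A = ⊥ ∨ B = ⊥

/-- The homogeneous endomorphisms that are not bijective. -/
def nonBijective : Set (Module.End Rᵐᵒᵖ M) :=
  {f | (∃ d, IsHomogeneousMap 𝓖 𝓖 d f) ∧ ¬ Function.Bijective f}

theorem isHomogeneousMap_of_mem_pow {k : ℕ} {f : Module.End Rᵐᵒᵖ M}
    (hf : f ∈ 𝓖.nonBijective ^ k) : ∃ d, IsHomogeneousMap 𝓖 𝓖 d f := by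
  induction k generalizing f with
  | zero =>
    rw [pow_zero, Set.mem_one] at hf
    exact ⟨0, fun n x => by simp [hf]⟩
  | succ k ih =>
    rw [pow_succ, Set.mem_mul] at hf
    obtain ⟨g, hg, h, ⟨⟨d, hd⟩, -⟩, rfl⟩ := hf
    obtain ⟨d', hd'⟩ := ih hg
    exact ⟨d + d', hd'.comp hd⟩

theorem exists_proj_eq_zero (hart : IsArtinianRing Rᵐᵒᵖ) (hbasic : IsBasic R)
    [Module.Finite Rᵐᵒᵖ M] : ∃ B : ℤ, 0 ≤ B ∧ ∀ n : ℤ, B < |n| → ∀ x, 𝓖.proj n x = 0 := by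
  classical
  obtain ⟨T, hT⟩ := exists_finset_closure_eq_top 𝒜 hart hbasic M
  let F : Finset ℤ := T.biUnion fun t => (𝓖.finite_proj_ne_zero t).toFinset
  refine ⟨∑ i ∈ F, |i|, Finset.sum_nonneg fun i _ => abs_nonneg i, fun n hn x => ?_⟩
  refine AddSubgroup.closure_induction (fun y hy => ?_) (map_zero _) (fun a b _ _ ha hb => ?_)
      (fun a _ ha => ?_) (hT x)
  · obtain ⟨t, ht, r, hr, rfl⟩ := hy
    have h1 : 𝓖.proj n t = 0 := by
      by_contra h
      have h2 : n ∈ F := Finset.mem_biUnion.mpr ⟨t, ht, by simpa using h⟩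
      have := Finset.single_le_sum (f := fun i : ℤ => |i|) (fun i _ => abs_nonneg i) h2
      omega
    rw [← add_zero n, 𝓖.proj_op_smul hr, h1, smul_zero]
  · rw [map_add, ha, hb, add_zero]
  · rw [map_neg, ha, neg_zero]

variable {𝓖} in
-- Powers of an injective map of nonzero degree would push a nonzero component out of the bounded
-- support.
theorem IsHomogeneousMap.not_bijective [Nontrivial M] {B : ℤ}
    (hB : ∀ n : ℤ, B < |n| → ∀ x, 𝓖.proj n x = 0) {d : ℤ} (hd : d ≠ 0) {f : Module.End Rᵐᵒᵖ M}
    (hf : IsHomogeneousMap 𝓖 𝓖 d f) : ¬ Function.Bijective f := by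
  intro hbij
  have hpow : ∀ (k : ℕ) (n : ℤ) (x : M), 𝓖.proj (n + k * d) ((f ^ k) x) = (f ^ k) (𝓖.proj n x) := by
    intro k
    induction k with
    | zero => simp
    | succ k ih =>
      intro n x
      have h1 : n + (k + 1 : ℕ) * d = (n + k * d) + d := by push_cast; ring
      rw [pow_succ', Module.End.mul_apply, Module.End.mul_apply, h1, hf, ih]
  obtain ⟨x, hx⟩ := exists_ne (0 : M)
  obtain ⟨n, hn⟩ : ∃ n, 𝓖.proj n x ≠ 0 := by
    by_contra! h
    exact hx (𝓖.ext_proj fun n => by rw [h, map_zero])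
  have hinj : Function.Injective (f ^ (B + |n| + 1).toNat) := by
    rw [Module.End.coe_pow]; exact hbij.1.iterate _
  refine hn (hinj ?_)
  rw [map_zero, ← hpow]
  refine hB _ ?_ _
  have hB0 : 0 ≤ B := by
    by_contra hB0
    exact hn (hB n (by have := abs_nonneg n; omega) x)
  have h1 : ((B + |n| + 1).toNat : ℤ) = B + |n| + 1 :=
    Int.toNat_of_nonneg (by have := abs_nonneg n; omega)
  rw [h1]
  have h2 : |(B + |n| + 1) * d| ≥ B + |n| + 1 := by
    rw [abs_mul, abs_of_nonneg (by have := abs_nonneg n; omega)]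
    have := Int.one_le_abs hd
    have h3 : 0 ≤ B + |n| + 1 := by have := abs_nonneg n; omega
    nlinarith
  have h3 := abs_sub_abs_le_abs_sub ((B + |n| + 1) * d) (-n)
  rw [abs_neg, sub_neg_eq_add, add_comm _ n] at h3
  omega

section FiniteLength

variable [IsArtinian Rᵐᵒᵖ M] [IsNoetherian Rᵐᵒᵖ M]

variable {𝓖} in
/-- The Harada–Sai lemma. -/
theorem IsIndecomposable.length_range_add_le (h𝓖 : 𝓖.IsIndecomposable) (m : ℕ) :
    ∀ f ∈ 𝓖.nonBijective ^ (2 ^ m - 1), f = 0 ∨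
      Module.length Rᵐᵒᵖ (LinearMap.range f) + m ≤ Module.length Rᵐᵒᵖ M := by
  induction m with
  | zero =>
    intro f _
    right
    rw [Nat.cast_zero, add_zero]
    exact Module.length_le_of_injective _ (Submodule.subtype_injective _)
  | succ m ih =>
    intro x hx
    -- The product is cut as `h * g * f` with one middle factor `g`, and induction applies to both
    -- `h` and `f`.
    have hexp : 2 ^ (m + 1) - 1 = (2 ^ m - 1) + 1 + (2 ^ m - 1) := by
      have := Nat.one_le_two_pow (n := m)
      rw [pow_succ]; omega
    rw [hexp, pow_add, pow_succ] at hx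
    obtain ⟨hg, ⟨h, hh, g, hgg, rfl⟩, f, hf, rfl⟩ := hx
    by_cases hx0 : h * g * f = 0
    · exact Or.inl hx0
    right
    have hh0 : h ≠ 0 := by rintro rfl; simp at hx0
    have hf0 : f ≠ 0 := by rintro rfl; simp at hx0
    have hlh := (ih h hh).resolve_left hh0
    have hlf := (ih f hf).resolve_left hf0
    have hfin : Module.length Rᵐᵒᵖ M ≠ ⊤ := Module.length_ne_top
    by_contra hlt
    rw [not_le] at hlt
    set ℓ := Module.length Rᵐᵒᵖ M
    set r := Module.length Rᵐᵒᵖ (LinearMap.range (h * g * f))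
    have hle : ∀ f : Module.End Rᵐᵒᵖ M, Module.length Rᵐᵒᵖ (LinearMap.range f) ≠ ⊤ :=
      fun f => Module.length_ne_top
    have hr : r ≠ ⊤ := hle _
    -- If the length of the range fails to drop once more, the ranges of `h`, `f` and `h * g * f`
    -- all have the same length.
    have hcmp : ∀ a : ℕ∞, a ≠ ⊤ → a + m ≤ ℓ → a ≤ r := by
      intro a ha h1
      clear_value ℓ r
      lift a to ℕ using ha
      lift ℓ to ℕ using hfin
      lift r to ℕ using hr
      norm_cast at h1 hlt ⊢
      omega
    have hrh := hcmp _ (hle h) hlh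
    have hrf := hcmp _ (hle f) hlf
    have hrange : LinearMap.range (h * g * f) = LinearMap.range h :=
      Submodule.eq_of_le_of_length_le (by
        rintro _ ⟨y, rfl⟩; exact ⟨g (f y), rfl⟩) hrh
    have hinj : Function.Injective ((h * g) ∘ₗ (LinearMap.range f).subtype) := by
      let q : LinearMap.range f →ₗ[Rᵐᵒᵖ] M := (h * g) ∘ₗ (LinearMap.range f).subtype
      have hsub : LinearMap.range q = LinearMap.range (h * g * f) := by
        rw [LinearMap.range_comp, Submodule.range_subtype, ← LinearMap.range_comp]; rfl
      let κ : LinearMap.ker q →ₗ[Rᵐᵒᵖ] LinearMap.range f := Submodule.subtype _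
      have hex := Module.length_eq_add_of_exact (R := Rᵐᵒᵖ) (M := LinearMap.range f)
        (N := LinearMap.ker q) (P := LinearMap.range q) κ q.rangeRestrict
        (Submodule.subtype_injective _) q.surjective_rangeRestrict
        (by rw [LinearMap.exact_iff, LinearMap.ker_rangeRestrict, Submodule.range_subtype])
      rw [hsub] at hex
      change _ = _ + r at hex
      have hk : Module.length Rᵐᵒᵖ (LinearMap.ker q) = 0 := by
        rw [hex] at hrf
        exact nonpos_iff_eq_zero.mp ((ENat.add_le_add_iff_right hr).mp (by rwa [zero_add]))
      rw [Module.length_eq_zero_iff, Submodule.subsingleton_iff_eq_bot] at hk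
      exact LinearMap.ker_eq_bot.mp hk
    obtain ⟨d, hd⟩ := 𝓖.isHomogeneousMap_of_mem_pow hh
    obtain ⟨d', hd'⟩ := 𝓖.isHomogeneousMap_of_mem_pow hf
    obtain ⟨⟨d'', hd''⟩, hnb⟩ := hgg
    -- `h` maps the range of `g * f` bijectively onto its own range. Indecomposability then forces
    -- `g * f = 0` or `g` surjective, and both are excluded.
    have hcompl : IsCompl (LinearMap.range (g * f)) (LinearMap.ker h) := by
      constructor
      · rw [Submodule.disjoint_def]
        rintro _ ⟨y, rfl⟩ hy
        have h1 := @hinj ⟨f y, y, rfl⟩ 0 (by simpa using hy)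
        have h2 : f y = 0 := congrArg Subtype.val h1
        simp [h2]
      · rw [codisjoint_iff, Submodule.eq_top_iff']
        intro y
        obtain ⟨z, hz⟩ : h y ∈ LinearMap.range (h * g * f) := hrange ▸ ⟨y, rfl⟩
        refine Submodule.mem_sup.mpr ⟨(g * f) z, ⟨z, rfl⟩, y - (g * f) z, ?_, by abel⟩
        rw [LinearMap.mem_ker, map_sub, ← hz]
        simp
    rcases h𝓖 _ _ (hd''.comp hd' |>.range) hd.ker hcompl with h1 | h1
    · refine hx0 ?_
      have h2 : g * f = 0 := LinearMap.range_eq_bot.mp h1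
      rw [mul_assoc, h2, mul_zero]
    · rw [h1] at hcompl
      have h2 : Function.Surjective g := by
        intro y
        have : y ∈ LinearMap.range (g * f) := by
          rw [eq_top_of_isCompl_bot hcompl]; trivial
        obtain ⟨z, rfl⟩ := this
        exact ⟨f z, rfl⟩
      exact hnb (IsNoetherian.bijective_of_surjective_endomorphism g h2)

variable {𝓖} in
-- A power of the span is the span of products, and a product of `2 ^ (ℓ + 1) - 1` factors vanishes
-- because length `ℓ` cannot drop by `ℓ + 1`.
theorem IsIndecomposable.isNilpotent_of_mem_span (h𝓖 : 𝓖.IsIndecomposable)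
    {f : Module.End Rᵐᵒᵖ M} (hf : f ∈ Submodule.span ℤ 𝓖.nonBijective) : IsNilpotent f := by
  obtain ⟨ℓ, hℓ⟩ := ENat.ne_top_iff_exists.mp (Module.length_ne_top (R := Rᵐᵒᵖ) (M := M))
  refine ⟨2 ^ (ℓ + 1) - 1, ?_⟩
  have h1 := Submodule.pow_mem_pow _ hf (2 ^ (ℓ + 1) - 1)
  rw [Submodule.span_pow] at h1
  have h2 : Submodule.span ℤ (𝓖.nonBijective ^ (2 ^ (ℓ + 1) - 1)) ≤ ⊥ := by
    rw [Submodule.span_le]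
    intro x hx
    rcases h𝓖.length_range_add_le _ x hx with h | h
    · exact h
    · exfalso
      rw [← hℓ] at h
      have := (le_add_self).trans h
      norm_cast at this
      omega
  exact h2 h1

end FiniteLength

section Bounded

variable {B : ℤ}

theorem exists_eq_part_zero_add_sum (hB : ∀ n : ℤ, B < |n| → ∀ x, 𝓖.proj n x = 0)
    (f : Module.End Rᵐᵒᵖ M) :
    ∃ s : Finset ℤ, (∀ d ∈ s, d ≠ 0) ∧ f = part 𝓖 𝓖 0 f + ∑ d ∈ s, part 𝓖 𝓖 d f := by
  classical
  -- Two degrees in `[-B, B]` differ by at most `2 * B`. Inserting `0` covers `B < 0`, where the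
  -- interval is empty.
  refine ⟨(insert 0 (Finset.Icc (-(2 * B)) (2 * B))).erase 0,
    fun d hd => Finset.ne_of_mem_erase hd, ?_⟩
  rw [Finset.add_sum_erase _ (fun d => part 𝓖 𝓖 d f) (Finset.mem_insert_self _ _)]
  refine eq_sum_part 𝓖 𝓖 fun d hd n x => ?_
  simp only [Finset.mem_insert, Finset.mem_Icc, not_or, not_and, not_le] at hd
  by_cases hn : B < |n|
  · rw [hB n hn, map_zero, map_zero]
  · refine hB _ ?_ _
    rw [not_lt, abs_le] at hn
    rw [lt_abs]
    by_cases h : -(2 * B) ≤ d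
    · have := hd.2 h; omega
    · omega

variable {𝓖} in
-- With `w` inverse to the degree zero part, `w ∘ₗ f` is `1` plus maps of nonzero degree, which lie
-- in the span of nilpotents: a unit.
theorem IsIndecomposable.bijective_of_part_zero [Nontrivial M]
    [IsArtinian Rᵐᵒᵖ M] [IsNoetherian Rᵐᵒᵖ M] (h𝓖 : 𝓖.IsIndecomposable)
    (hB : ∀ n : ℤ, B < |n| → ∀ x, 𝓖.proj n x = 0) {f : Module.End Rᵐᵒᵖ M}
    (hf : Function.Bijective (part 𝓖 𝓖 0 f)) : Function.Bijective f := by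
  obtain ⟨s, hs, hfs⟩ := 𝓖.exists_eq_part_zero_add_sum hB f
  let w := (LinearEquiv.ofBijective _ hf).symm.toLinearMap
  have hw1 : ∀ x, w (part 𝓖 𝓖 0 f x) = x := (LinearEquiv.ofBijective _ hf).symm_apply_apply
  have hw2 : ∀ x, part 𝓖 𝓖 0 f (w x) = x := (LinearEquiv.ofBijective _ hf).apply_symm_apply
  have hw : IsHomogeneousMap 𝓖 𝓖 0 w := fun n x => by
    apply hf.1
    rw [hw2, ← part_isHomogeneousMap 𝓖 𝓖 0 f, add_zero, add_zero, hw2]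
  have h1 : (w ∘ₗ f : Module.End Rᵐᵒᵖ M) = ∑ d ∈ s, w ∘ₗ part 𝓖 𝓖 d f + 1 := by
    ext x
    conv_lhs => rw [hfs]
    simp [hw1, add_comm]
  have h2 : ∑ d ∈ s, w ∘ₗ part 𝓖 𝓖 d f ∈ Submodule.span ℤ 𝓖.nonBijective := by
    refine sum_mem fun d hd => Submodule.subset_span ⟨⟨d, ?_⟩, ?_⟩
    · have := hw.comp (part_isHomogeneousMap 𝓖 𝓖 d f)
      rwa [add_zero] at this
    · have := hw.comp (part_isHomogeneousMap 𝓖 𝓖 d f)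
      rw [add_zero] at this
      exact this.not_bijective hB (hs d hd)
  have h3 : IsUnit (w ∘ₗ f : Module.End Rᵐᵒᵖ M) := by
    rw [h1]
    exact (h𝓖.isNilpotent_of_mem_span h2).isUnit_add_one
  rw [Module.End.isUnit_iff] at h3
  have h4 : (f : M → M) = part 𝓖 𝓖 0 f ∘ (w ∘ₗ f : Module.End Rᵐᵒᵖ M) := by
    funext x
    simp [hw2]
  rw [h4]
  exact hf.comp h3

variable {𝓖} in
-- A substitute for locality of the endomorphism ring: otherwise all homogeneous parts of the
-- summands are non-bijective, and `1` would be nilpotent.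
theorem IsIndecomposable.exists_bijective_of_sum_eq_one [Nontrivial M]
    [IsArtinian Rᵐᵒᵖ M] [IsNoetherian Rᵐᵒᵖ M] (h𝓖 : 𝓖.IsIndecomposable)
    (hB : ∀ n : ℤ, B < |n| → ∀ x, 𝓖.proj n x = 0) {ι : Type*} (s : Finset ι)
    (f : ι → Module.End Rᵐᵒᵖ M) (hf : ∑ i ∈ s, f i = 1) : ∃ i ∈ s, Function.Bijective (f i) := by
  by_contra! h
  have h1 : (1 : Module.End Rᵐᵒᵖ M) ∈ Submodule.span ℤ 𝓖.nonBijective := by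
    rw [← hf]
    refine sum_mem fun i hi => ?_
    obtain ⟨s, hs, hfs⟩ := 𝓖.exists_eq_part_zero_add_sum hB (f i)
    rw [hfs]
    refine add_mem (Submodule.subset_span ⟨⟨0, part_isHomogeneousMap 𝓖 𝓖 0 _⟩,
      fun h' => h i hi (h𝓖.bijective_of_part_zero hB h')⟩) (sum_mem fun d hd =>
      Submodule.subset_span ⟨⟨d, part_isHomogeneousMap 𝓖 𝓖 d _⟩,
        (part_isHomogeneousMap 𝓖 𝓖 d _).not_bijective hB (hs d hd)⟩)
  obtain ⟨k, hk⟩ := h𝓖.isNilpotent_of_mem_span h1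
  rw [one_pow] at hk
  exact one_ne_zero hk

end Bounded

end Grading

/-! ### Components of `P_N`, its grading and the Prüfer property. -/

section Prufer

variable {R : Type u} [Ring R] (𝒜 : ℤ → AddSubgroup R)
variable (N : Type*) [AddCommGroup N] [Module Rᵐᵒᵖ N]

/-- The subgroup of `N` generated by the products of elements with homogeneous ring elements of
degree at least `k`. -/
def degreeImage (k : ℤ) : AddSubgroup N :=
  AddSubgroup.closure {y | ∃ m : N, ∃ j : ℤ, k ≤ j ∧ ∃ r ∈ 𝒜 j, y = op r • m}

variable {𝒜 N} in
theorem op_smul_mem_degreeImage {k j : ℤ} (h : k ≤ j) {r : R} (hr : r ∈ 𝒜 j) (m : N) :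
    op r • m ∈ degreeImage 𝒜 N k :=
  AddSubgroup.subset_closure ⟨m, j, h, r, hr, rfl⟩

theorem degreeImage_eq_bot {L : ℤ} (hL : ∀ j : ℤ, L ≤ |j| → ∀ r ∈ 𝒜 j, r = 0) {k : ℤ}
    (hk : L ≤ k) : degreeImage 𝒜 N k = ⊥ := by
  rw [degreeImage, AddSubgroup.closure_eq_bot_iff]
  rintro _ ⟨m, j, hj, r, hr, rfl⟩
  rw [hL j (by have := le_abs_self j; omega) r hr, op_zero, zero_smul]
  rfl

variable [GradedRing 𝒜]

theorem degreeImage_eq_top {k : ℤ} (hk : k ≤ 0) : degreeImage 𝒜 N k = ⊤ := by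
  rw [AddSubgroup.eq_top_iff']
  intro m
  have := op_smul_mem_degreeImage (𝒜 := 𝒜) hk (SetLike.GradedOne.one_mem (A := 𝒜)) m
  rwa [op_one, one_smul] at this

variable {𝒜 N} in
theorem op_smul_degreeImage {k j : ℤ} {r : R} (hr : r ∈ 𝒜 j) {y : N}
    (hy : y ∈ degreeImage 𝒜 N k) : op r • y ∈ degreeImage 𝒜 N (k + j) := by
  refine AddSubgroup.closure_induction (fun y hy => ?_) ?_ (fun a b _ _ ha hb => ?_)
      (fun a _ ha => ?_) hy
  · obtain ⟨m, i, hi, s, hs, rfl⟩ := hy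
    rw [← mul_smul, ← op_mul]
    exact op_smul_mem_degreeImage (by omega) (SetLike.mul_mem_graded hs hr) m
  · rw [smul_zero]; exact zero_mem _
  · rw [smul_add]; exact add_mem ha hb
  · rw [smul_neg]; exact neg_mem ha

/-- A Nakayama argument: if products of positive degree filled `N`, iterating would make products of
degree at least `L` fill it, but these vanish. -/
theorem degreeImage_one_ne_top [Nontrivial N] {L : ℤ} (hL0 : 0 < L)
    (hL : ∀ j : ℤ, L ≤ |j| → ∀ r ∈ 𝒜 j, r = 0) : degreeImage 𝒜 N 1 ≠ ⊤ := by
  intro htop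
  have key : ∀ k : ℕ, degreeImage 𝒜 N (1 + k) = ⊤ := by
    intro k
    induction k with
    | zero => simpa using htop
    | succ k ih =>
      rw [eq_top_iff, ← htop, degreeImage, AddSubgroup.closure_le]
      rintro _ ⟨m, j, hj, r, hr, rfl⟩
      have hm : m ∈ degreeImage 𝒜 N (1 + k) := ih ▸ AddSubgroup.mem_top m
      refine AddSubgroup.closure_mono ?_ (op_smul_degreeImage hr hm)
      rintro _ ⟨m, i, hi, s, hs, rfl⟩
      exact ⟨m, i, by push_cast; omega, s, hs, rfl⟩
  have h1 := key L.toNat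
  rw [degreeImage_eq_bot 𝒜 N hL (by omega)] at h1
  exact bot_ne_top h1

variable {𝒜 N} in
-- For `r` of degree `j`, `(m r) eₙ = (m eₙ₋ⱼ) r`, and `n - j < 0` means `j ≥ n + 1`. This
-- identifies the degree `n` component of `P_N`.
theorem mem_negativePart_iff (x : PullUp 𝒜 N) :
    x ∈ negativePart 𝒜 N ↔ ∀ n, coeff n x ∈ degreeImage 𝒜 N (n + 1) := by
  classical
  constructor
  · intro hx
    induction hx using Submodule.span_induction with
    | mem x h =>
      obtain ⟨i, hi, m, rfl⟩ := h
      intro n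
      rw [coeff_e]
      split_ifs with h
      · rw [degreeImage_eq_top 𝒜 N (by omega)]; trivial
      · exact zero_mem _
    | zero => intro n; rw [map_zero]; exact zero_mem _
    | add x y _ _ hx hy => intro n; rw [map_add]; exact add_mem (hx n) (hy n)
    | smul s x _ hx =>
      obtain ⟨r, rfl⟩ := op_surjective s
      induction r using DirectSum.Decomposition.inductionOn 𝒜 with
      | zero => intro n; rw [op_zero, zero_smul, map_zero]; exact zero_mem _
      | add a b ha hb => intro n; rw [op_add, add_smul, map_add]; exact add_mem (ha n) (hb n)
      | @homogeneous j a =>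
        intro n
        have h1 := coeff_op_smul a.2 (n - j) x
        have h2 := op_smul_degreeImage a.2 (hx (n - j))
        rw [sub_add_cancel] at h1
        rw [add_right_comm, sub_add_cancel] at h2
        rw [h1]
        exact h2
  · intro h
    rw [eq_sum (x := x) (s := (finite_coeff_ne_zero x).toFinset) (by simp)]
    refine sum_mem fun n _ => ?_
    refine AddSubgroup.closure_induction (fun y hy => ?_) ?_ (fun a b _ _ ha hb => ?_)
      (fun a _ ha => ?_) (h n)
    · obtain ⟨m, j, hj, r, hr, rfl⟩ := hy
      have := op_smul_e 𝒜 N hr (n - j) m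
      rw [sub_add_cancel] at this
      rw [← this]
      exact Submodule.smul_mem _ _ (Submodule.subset_span ⟨n - j, by omega, m, rfl⟩)
    · rw [map_zero]; exact zero_mem _
    · rw [map_add]; exact add_mem ha hb
    · rw [map_neg]; exact neg_mem ha

variable {N} in
/-- The class of `m eₙ` in `P_N`. -/
noncomputable def mk (n : ℤ) : N →+ PruferQuotient 𝒜 N :=
  (negativePart 𝒜 N).mkQ.toAddMonoidHom.comp (e 𝒜 n)

variable {𝒜 N}

@[simp]
theorem mkQ_e (n : ℤ) (m : N) : (negativePart 𝒜 N).mkQ (e 𝒜 n m) = mk 𝒜 n m := rfl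

theorem mk_eq_zero_iff {n : ℤ} {m : N} : mk 𝒜 n m = 0 ↔ m ∈ degreeImage 𝒜 N (n + 1) := by
  rw [← mkQ_e, Submodule.mkQ_apply, Submodule.Quotient.mk_eq_zero, mem_negativePart_iff]
  constructor
  · intro h
    simpa using h n
  · intro h k
    rw [coeff_e]
    split_ifs with hk
    · exact hk ▸ h
    · exact zero_mem _

theorem mk_of_neg {n : ℤ} (hn : n < 0) (m : N) : mk 𝒜 n m = 0 := by
  rw [mk_eq_zero_iff, degreeImage_eq_top 𝒜 N (by omega)]; trivial

theorem op_smul_mk {j : ℤ} {r : R} (hr : r ∈ 𝒜 j) (n : ℤ) (m : N) :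
    op r • mk 𝒜 n m = mk 𝒜 (n + j) (op r • m) := by
  rw [← mkQ_e, ← mkQ_e, ← op_smul_e 𝒜 N hr, map_smul]

theorem PruferQuotient.induction_on {p : PruferQuotient 𝒜 N → Prop} (x : PruferQuotient 𝒜 N)
    (zero : p 0) (add : ∀ x y, p x → p y → p (x + y)) (mk : ∀ n m, p (mk 𝒜 n m)) : p x := by
  obtain ⟨x, rfl⟩ := Submodule.mkQ_surjective _ x
  induction x using PullUp.induction_on with
  | zero => rwa [map_zero]
  | add x y hx hy => rw [map_add]; exact add _ _ hx hy
  | single n m => exact mk n m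

section Lift

variable {G : Type*} [AddCommGroup G] [Module Rᵐᵒᵖ G]

/-- A linear map out of the pull-up that vanishes on the components of negative degree descends to
`P_N`. -/
noncomputable def liftP (f : PullUp 𝒜 N →ₗ[Rᵐᵒᵖ] G) (h : ∀ n < 0, ∀ m, f (e 𝒜 n m) = 0) :
    PruferQuotient 𝒜 N →ₗ[Rᵐᵒᵖ] G :=
  (negativePart 𝒜 N).liftQ f (by
    rw [negativePart, Submodule.span_le]
    rintro _ ⟨n, hn, m, rfl⟩
    exact h n hn m)

@[simp]
theorem liftP_mk (f : PullUp 𝒜 N →ₗ[Rᵐᵒᵖ] G) (h : ∀ n < 0, ∀ m, f (e 𝒜 n m) = 0) (n : ℤ) (m : N) :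
    liftP f h (mk 𝒜 n m) = f (e 𝒜 n m) := rfl

end Lift

variable (𝒜 N) in
/-- The grading of `P_N`. -/
noncomputable def pruferGrading : Grading 𝒜 (PruferQuotient 𝒜 N) where
  coact := liftP (lift (fun n => (e 𝒜 n).comp (mk 𝒜 n)) fun j r hr n m => by
      simp [op_smul_e 𝒜 _ hr, op_smul_mk hr]) fun n hn m => by
    simp [mk_of_neg hn]
  counit_coact x := by
    induction x using PruferQuotient.induction_on with
    | zero => simp
    | add x y hx hy => simp [hx, hy]
    | mk n m => simp
  coact_coeff n x := by
    induction x using PruferQuotient.induction_on with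
    | zero => simp
    | add x y hx hy => simp [hx, hy]
    | mk k m =>
      rw [liftP_mk, lift_e, AddMonoidHom.comp_apply, coeff_e]
      split_ifs with h
      · subst h; simp
      · simp

theorem pruferGrading_proj_mk (n k : ℤ) (m : N) :
    (pruferGrading 𝒜 N).proj n (mk 𝒜 k m) = if k = n then mk 𝒜 k m else 0 := by
  rw [← Grading.coeff_coact]
  simp [pruferGrading, coeff_e]

theorem exists_mk_of_proj_eq {n : ℤ} {x : PruferQuotient 𝒜 N}
    (hx : (pruferGrading 𝒜 N).proj n x = x) : ∃ m, x = mk 𝒜 n m := by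
  have : ∀ y, ∃ m, (pruferGrading 𝒜 N).proj n y = mk 𝒜 n m := by
    intro y
    induction y using PruferQuotient.induction_on with
    | zero => exact ⟨0, by simp⟩
    | add x y hx hy =>
      obtain ⟨a, ha⟩ := hx
      obtain ⟨b, hb⟩ := hy
      exact ⟨a + b, by rw [map_add, map_add, ha, hb]⟩
    | mk k m =>
      rw [pruferGrading_proj_mk]
      split_ifs with h
      · exact ⟨m, by rw [h]⟩
      · exact ⟨0, by simp⟩
  obtain ⟨m, hm⟩ := this x
  exact ⟨m, hx ▸ hm⟩

variable (𝒜 N) in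
/-- The submodule of `P_N` generated by the components of degree at most `d`. -/
noncomputable def bounded (d : ℤ) : Submodule Rᵐᵒᵖ (PruferQuotient 𝒜 N) :=
  Submodule.span Rᵐᵒᵖ {x | ∃ n ≤ d, ∃ m, x = mk 𝒜 n m}

theorem mk_mem_bounded {n d : ℤ} (h : n ≤ d) (m : N) : mk 𝒜 n m ∈ bounded 𝒜 N d :=
  Submodule.subset_span ⟨n, h, m, rfl⟩

theorem bounded_mono {d d' : ℤ} (h : d ≤ d') : bounded 𝒜 N d ≤ bounded 𝒜 N d' :=
  Submodule.span_mono fun _ ⟨n, hn, m, hx⟩ => ⟨n, hn.trans h, m, hx⟩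

theorem exists_mem_bounded (x : PruferQuotient 𝒜 N) : ∃ d : ℕ, x ∈ bounded 𝒜 N d := by
  induction x using PruferQuotient.induction_on with
  | zero => exact ⟨0, zero_mem _⟩
  | add x y hx hy =>
    obtain ⟨a, ha⟩ := hx
    obtain ⟨b, hb⟩ := hy
    exact ⟨a + b, add_mem (bounded_mono (by push_cast; omega) ha)
      (bounded_mono (by push_cast; omega) hb)⟩
  | mk n m => exact ⟨n.toNat, mk_mem_bounded (Int.self_le_toNat n) m⟩

theorem mk_mem_of_forall {n : ℤ} {W : Submodule Rᵐᵒᵖ (PruferQuotient 𝒜 N)} {T : Finset N}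
    (hT : ∀ x : N, x ∈ AddSubgroup.closure {y | ∃ t ∈ T, ∃ r ∈ 𝒜 0, y = op r • t})
    (h : ∀ t ∈ T, mk 𝒜 n t ∈ W) (m : N) : mk 𝒜 n m ∈ W := by
  refine AddSubgroup.closure_induction (fun y hy => ?_) ?_ (fun a b _ _ ha hb => ?_)
      (fun a _ ha => ?_) (hT m)
  · obtain ⟨t, ht, r, hr, rfl⟩ := hy
    have := op_smul_mk hr n t
    rw [add_zero] at this
    rw [← this]
    exact W.smul_mem _ (h t ht)
  · rw [map_zero]; exact zero_mem _
  · rw [map_add]; exact add_mem ha hb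
  · rw [map_neg]; exact neg_mem ha

theorem isFiniteLength_of_fg (hart : IsArtinianRing Rᵐᵒᵖ) {M : Type*} [AddCommGroup M]
    [Module Rᵐᵒᵖ M] {W : Submodule Rᵐᵒᵖ M} (h : W.FG) : IsFiniteLength Rᵐᵒᵖ W := by
  have : Module.Finite Rᵐᵒᵖ W := Module.Finite.iff_fg.mpr h
  exact isFiniteLength_iff_isNoetherian_isArtinian.mpr ⟨inferInstance, inferInstance⟩

theorem isFiniteLength_bounded (hart : IsArtinianRing Rᵐᵒᵖ) (hbasic : IsBasic R)
    [Module.Finite Rᵐᵒᵖ N] (d : ℤ) : IsFiniteLength Rᵐᵒᵖ (bounded 𝒜 N d) := by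
  classical
  obtain ⟨T, hT⟩ := exists_finset_closure_eq_top 𝒜 hart hbasic N
  refine isFiniteLength_of_fg hart ⟨(Finset.Icc 0 d ×ˢ T).image fun p => mk 𝒜 p.1 p.2, ?_⟩
  apply le_antisymm
  · rw [Submodule.span_le]
    intro x hx
    simp only [Finset.coe_image, Set.mem_image, Finset.mem_coe, Finset.mem_product,
      Finset.mem_Icc] at hx
    obtain ⟨p, ⟨⟨-, hp⟩, -⟩, rfl⟩ := hx
    exact mk_mem_bounded hp _
  · rw [bounded, Submodule.span_le]
    rintro _ ⟨n, hn, m, rfl⟩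
    rcases lt_or_ge n 0 with h | h
    · rw [mk_of_neg h]; exact zero_mem _
    · refine mk_mem_of_forall hT (fun t ht => Submodule.subset_span ?_) m
      exact Finset.mem_coe.mpr (Finset.mem_image.mpr
        ⟨(n, t), by simp [h, hn, ht], rfl⟩)

theorem coeff_shift (n k : ℤ) (x : PullUp 𝒜 N) : coeff n (shift 𝒜 N k x) = coeff (n - k) x := by
  induction x using PullUp.induction_on with
  | zero => simp
  | add x y hx hy => simp [hx, hy]
  | single i m =>
    rw [shift_e, coeff_e, coeff_e]
    congr 1
    exact propext ⟨fun h => by omega, fun h => by omega⟩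

variable (𝒜 N) in
/-- The endomorphism of `P_N` induced by the shift `m eₙ ↦ m eₙ₋₁`. -/
noncomputable def pruferShift : Module.End Rᵐᵒᵖ (PruferQuotient 𝒜 N) :=
  liftP ((negativePart 𝒜 N).mkQ ∘ₗ shift 𝒜 N (-1)) fun n hn m => by
    rw [LinearMap.comp_apply, shift_e, mkQ_e, mk_of_neg (by omega)]

@[simp]
theorem pruferShift_mk (n : ℤ) (m : N) : pruferShift 𝒜 N (mk 𝒜 n m) = mk 𝒜 (n - 1) m := by
  rw [pruferShift, liftP_mk, LinearMap.comp_apply, shift_e, mkQ_e, sub_eq_add_neg]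

theorem pruferShift_pow_mk (k : ℕ) (n : ℤ) (m : N) :
    (pruferShift 𝒜 N ^ k) (mk 𝒜 n m) = mk 𝒜 (n - k) m := by
  induction k with
  | zero => simp
  | succ k ih =>
    rw [pow_succ', Module.End.mul_apply, ih, pruferShift_mk, Nat.cast_succ, sub_sub]

theorem isPruferModule_pruferQuotient (hart : IsArtinianRing Rᵐᵒᵖ) (hbasic : IsBasic R)
    [Module.Finite Rᵐᵒᵖ N] [Nontrivial N] : IsPruferModule Rᵐᵒᵖ (PruferQuotient 𝒜 N) := by
  obtain ⟨L, hL0, hL⟩ := exists_bound 𝒜 hart hbasic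
  refine ⟨pruferShift 𝒜 N, fun x => ?_, fun x => ?_, fun hker => ?_, ?_⟩
  · induction x using PruferQuotient.induction_on with
    | zero => exact ⟨0, map_zero _⟩
    | add x y hx hy =>
      obtain ⟨a, ha⟩ := hx
      obtain ⟨b, hb⟩ := hy
      refine ⟨a + b, ?_⟩
      have hx : (pruferShift 𝒜 N ^ (a + b)) x = 0 := by
        rw [add_comm, pow_add, Module.End.mul_apply, ha, map_zero]
      have hy : (pruferShift 𝒜 N ^ (a + b)) y = 0 := by
        rw [pow_add, Module.End.mul_apply, hb, map_zero]
      rw [map_add, hx, hy, add_zero]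
    | mk n m =>
      refine ⟨(n + 1).toNat, ?_⟩
      rw [pruferShift_pow_mk]
      exact mk_of_neg (by omega) m
  · induction x using PruferQuotient.induction_on with
    | zero => exact ⟨0, map_zero _⟩
    | add x y hx hy =>
      obtain ⟨a, ha⟩ := hx
      obtain ⟨b, hb⟩ := hy
      exact ⟨a + b, by rw [map_add, ha, hb]⟩
    | mk n m => exact ⟨mk 𝒜 (n + 1) m, by simp⟩
  -- The shift kills the whole degree `0` component; a trivial kernel would make that component
  -- zero.
  · refine degreeImage_one_ne_top 𝒜 N hL0 hL ?_
    rw [AddSubgroup.eq_top_iff']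
    intro m
    have h1 : mk 𝒜 0 m ∈ LinearMap.ker (pruferShift 𝒜 N) := by
      rw [LinearMap.mem_ker, pruferShift_mk]
      exact mk_of_neg (by omega) m
    rw [hker, Submodule.mem_bot, mk_eq_zero_iff] at h1
    exact h1
  -- A coefficient at `n` of a kernel element is a sum of products `m r` with `r` of degree `j ≥ n`,
  -- and `(m r) eₙ` comes from `m eₙ₋ⱼ` in degree at most `0`.
  · have hle : LinearMap.ker (pruferShift 𝒜 N) ≤ bounded 𝒜 N 0 := by
      intro x hx
      obtain ⟨y, rfl⟩ := Submodule.mkQ_surjective _ x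
      have h1 : shift 𝒜 N (-1) y ∈ negativePart 𝒜 N := by
        rw [← Submodule.ker_mkQ (negativePart 𝒜 N)]; exact hx
      rw [mem_negativePart_iff] at h1
      have h2 : ∀ n, coeff n y ∈ degreeImage 𝒜 N n := fun n => by
        have := h1 (n - 1)
        rwa [coeff_shift, sub_neg_eq_add, sub_add_cancel] at this
      rw [eq_sum (x := y) (s := (finite_coeff_ne_zero y).toFinset) (by simp), map_sum]
      refine sum_mem fun n _ => ?_
      rw [mkQ_e]
      refine AddSubgroup.closure_induction (fun y hy => ?_) ?_ (fun a b _ _ ha hb => ?_)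
        (fun a _ ha => ?_) (h2 n)
      · obtain ⟨m, j, hj, r, hr, rfl⟩ := hy
        have := op_smul_mk hr (n - j) m
        rw [sub_add_cancel] at this
        rw [← this]
        exact Submodule.smul_mem _ _ (mk_mem_bounded (by omega) m)
      · rw [map_zero]; exact zero_mem _
      · rw [map_add]; exact add_mem ha hb
      · rw [map_neg]; exact neg_mem ha
    exact (isFiniteLength_bounded hart hbasic 0).of_injective (Submodule.inclusion_injective hle)

end Prufer

/-! ### Finite type in terms of retracts of `X^(ι)`. -/

section FiniteType

variable {S : Type u} [Ring S] {M : Type v} [AddCommGroup M] [Module S M]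

theorem HasFiniteType.exists_retraction (h : HasFiniteType S M) :
    ∃ (X : Type (max u v)) (_ : AddCommGroup X) (_ : Module S X), IsFiniteLength S X ∧
      ∃ (ι : Type (max u v)) (s : M →ₗ[S] ι →₀ X) (t : (ι →₀ X) →ₗ[S] M), ∀ x, t (s x) = x := by
  obtain ⟨X, i1, i2, hX, ι, A, B, hAB, ⟨f⟩⟩ := h
  refine ⟨X, i1, i2, hX, ι, A.subtype ∘ₗ f.toLinearMap,
    f.symm.toLinearMap ∘ₗ A.projectionOnto B hAB, fun x => ?_⟩
  simp

theorem HasFiniteType.of_retraction {X : Type (max u v)} [AddCommGroup X] [Module S X]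
    (hX : IsFiniteLength S X) {ι : Type (max u v)} (s : M →ₗ[S] ι →₀ X) (t : (ι →₀ X) →ₗ[S] M)
    (h : ∀ x, t (s x) = x) : HasFiniteType S M := by
  refine ⟨X, _, _, hX, ι, LinearMap.range s, LinearMap.ker t, ⟨?_, ?_⟩,
    ⟨LinearEquiv.ofInjective s (Function.LeftInverse.injective h)⟩⟩
  · rw [Submodule.disjoint_def]
    rintro _ ⟨x, rfl⟩ hx
    rw [LinearMap.mem_ker, h] at hx
    rw [hx, map_zero]
  · rw [codisjoint_iff, Submodule.eq_top_iff']
    intro y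
    exact Submodule.mem_sup.mpr ⟨s (t y), ⟨t y, rfl⟩, y - s (t y), by simp [h], by abel⟩

theorem HasFiniteType.of_retract {M' : Type v} [AddCommGroup M'] [Module S M']
    (h : HasFiniteType S M) (i : M' →ₗ[S] M) (p : M →ₗ[S] M') (hpi : ∀ x, p (i x) = x) :
    HasFiniteType S M' := by
  obtain ⟨X, _, _, hX, ι, s, t, hts⟩ := h.exists_retraction
  exact .of_retraction hX (s ∘ₗ i) (p ∘ₗ t) fun x => by simp [hts, hpi]

/-- A pointwise finite family assembles into maps to and from the direct sum. Allowing every larger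
`F'` makes the condition additive in `x`, so it can be checked on generators. -/
theorem HasFiniteType.of_family {X : Type v} [AddCommGroup X] [Module S X]
    (hX : IsFiniteLength S X) {ι : Type (max u v)} (s : ι → M →ₗ[S] X) (t : ι → X →ₗ[S] M)
    (h : ∀ x, ∃ F : Finset ι, (∀ k ∉ F, s k x = 0) ∧
      ∀ F' : Finset ι, F ⊆ F' → ∑ k ∈ F', t k (s k x) = x) : HasFiniteType S M := by
  have hfin : ∀ x, (Function.support fun k => (ULift.up (s k x) : ULift.{u} X)).Finite := by
    intro x
    obtain ⟨F, hF, -⟩ := h x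
    refine F.finite_toSet.subset fun k hk => ?_
    by_contra hkF
    exact hk (congrArg ULift.up (hF k hkF))
  let s' : M →ₗ[S] ι →₀ ULift.{u} X :=
    { toFun x := Finsupp.ofSupportFinite _ (hfin x)
      map_add' x y := by ext k; exact map_add (s k) x y
      map_smul' r x := by ext k; exact map_smul (s k) r x }
  have hX' : IsFiniteLength S (ULift.{u} X) :=
    (ULift.moduleEquiv.symm : X ≃ₗ[S] ULift.{u} X).isFiniteLength hX
  refine .of_retraction hX' s'
    (Finsupp.lsum ℕ fun k => t k ∘ₗ (ULift.moduleEquiv : ULift.{u} X ≃ₗ[S] X).toLinearMap)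
    fun x => ?_
  obtain ⟨F, hF, hF'⟩ := h x
  rw [Finsupp.lsum_apply, Finsupp.sum_of_support_subset _ (s := F)]
  · exact hF' F subset_rfl
  · intro k hk
    by_contra hkF
    exact (Finsupp.mem_support_iff.mp hk) (by
      change ULift.up (s k x) = 0
      rw [hF k hkF]; rfl)
  · intro k _
    exact map_zero _

end FiniteType

/-! ### Equivalence of internal gradings and coactions. -/

section Gradable

variable {R : Type u} [Ring R] {𝒜 : ℤ → AddSubgroup R} [GradedRing 𝒜]
variable {M : Type v} [AddCommGroup M] [Module Rᵐᵒᵖ M]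

theorem IsModuleGrading.nonempty_grading {𝓜 : ℤ → AddSubgroup M} (h : IsModuleGrading 𝒜 𝓜) :
    Nonempty (Grading 𝒜 M) := by
  classical
  let _ := h.isInternal.chooseDecomposition
  let D : M →+ PullUp 𝒜 M := (DirectSum.toAddMonoid fun n => (e 𝒜 n).comp (𝓜 n).subtype).comp
    (DirectSum.decomposeAddEquiv 𝓜).toAddMonoidHom
  have hD : ∀ {n : ℤ} {x : M}, x ∈ 𝓜 n → D x = e 𝒜 n x := fun hx => by
    simp [D, DirectSum.decompose_of_mem 𝓜 hx]
  have hsmul : ∀ (s : Rᵐᵒᵖ) (x : M), D (s • x) = s • D x := by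
    intro s x
    obtain ⟨r, rfl⟩ := op_surjective s
    induction r using DirectSum.Decomposition.inductionOn 𝒜 with
    | zero => simp
    | add a b ha hb => rw [op_add, add_smul, map_add, ha, hb, add_smul]
    | @homogeneous j a =>
      induction x using DirectSum.Decomposition.inductionOn 𝓜 with
      | zero => simp
      | add x y hx hy => rw [smul_add, map_add, hx, hy, map_add, smul_add]
      | @homogeneous i x => rw [hD x.2, hD (h.smul_mem x.2 a.2), op_smul_e 𝒜 M a.2]
  refine ⟨{ coact := { toFun := D, map_add' := map_add D, map_smul' := hsmul },
            counit_coact := fun x => ?_, coact_coeff := fun n x => ?_ }⟩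
  · change counit 𝒜 M (D x) = x
    induction x using DirectSum.Decomposition.inductionOn 𝓜 with
    | zero => simp
    | add x y hx hy => rw [map_add, map_add, hx, hy]
    | @homogeneous i x => rw [hD x.2, counit_e]
  · change D (coeff n (D x)) = e 𝒜 n (coeff n (D x))
    induction x using DirectSum.Decomposition.inductionOn 𝓜 with
    | zero => simp
    | add x y hx hy => simp only [map_add, hx, hy]
    | @homogeneous i x =>
      rw [hD x.2, coeff_e]
      split_ifs with hi
      · subst hi; rw [hD x.2]
      · rw [map_zero, map_zero]

theorem Grading.isModuleGrading (𝓖 : Grading 𝒜 M) :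
    IsModuleGrading 𝒜 fun n => (𝓖.proj n).range := by
  classical
  refine ⟨⟨?_, ?_⟩, ?_⟩
  · rw [injective_iff_map_eq_zero]
    intro x hx
    have key : ∀ (n : ℤ) (x : DirectSum ℤ fun n => (𝓖.proj n).range),
        𝓖.proj n (DirectSum.coeAddMonoidHom (fun n => (𝓖.proj n).range) x) = x n := by
      intro n x
      induction x using DirectSum.induction_on with
      | zero => simp
      | of i y =>
        obtain ⟨_, y, rfl⟩ := y
        rw [DirectSum.coeAddMonoidHom_of, DirectSum.coe_of_apply]
        split_ifs with h
        · subst h; exact 𝓖.proj_proj_same i y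
        · exact 𝓖.proj_proj_of_ne h y
      | add x y hx hy => rw [map_add, map_add, hx, hy]; rfl
    ext n
    rw [← key, hx, map_zero]; rfl
  · intro x
    refine ⟨∑ n ∈ (𝓖.finite_proj_ne_zero x).toFinset, DirectSum.of _ n ⟨𝓖.proj n x, x, rfl⟩, ?_⟩
    rw [map_sum]
    conv_rhs => rw [𝓖.eq_sum_proj (x := x) (s := (𝓖.finite_proj_ne_zero x).toFinset) (by simp)]
    exact Finset.sum_congr rfl fun n _ => DirectSum.coeAddMonoidHom_of _ _ _
  · rintro i j _ r ⟨x, rfl⟩ hr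
    exact ⟨op r • x, 𝓖.proj_op_smul hr i x⟩

theorem isGradable_iff_nonempty_grading : IsGradable 𝒜 M ↔ Nonempty (Grading 𝒜 M) := by
  constructor
  · rintro ⟨M', _, _, 𝓜, h, ⟨f⟩⟩
    obtain ⟨𝓖⟩ := h.nonempty_grading
    exact ⟨𝓖.ofRetract f.toLinearMap f.symm.toLinearMap (by simp) fun n x => by simp⟩
  · rintro ⟨𝓖⟩
    exact ⟨M, _, _, _, 𝓖.isModuleGrading, ⟨LinearEquiv.refl _ _⟩⟩

variable {M' : Type*} [AddCommGroup M'] [Module Rᵐᵒᵖ M']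

/-- The grading of a product. -/
noncomputable def Grading.prod (𝓖 : Grading 𝒜 M) (𝓖' : Grading 𝒜 M') : Grading 𝒜 (M × M') where
  coact := map (LinearMap.inl _ _ _) ∘ₗ 𝓖.coact ∘ₗ LinearMap.fst _ _ _ +
    map (LinearMap.inr _ _ _) ∘ₗ 𝓖'.coact ∘ₗ LinearMap.snd _ _ _
  counit_coact x := by
    simp [PullUp.counit_map, Grading.counit_coact]
  coact_coeff n x := by
    have h1 : coeff n ((map (LinearMap.inl _ _ _) ∘ₗ 𝓖.coact ∘ₗ LinearMap.fst _ _ _ +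
        map (LinearMap.inr _ _ _) ∘ₗ 𝓖'.coact ∘ₗ LinearMap.snd _ _ _ :
          M × M' →ₗ[Rᵐᵒᵖ] PullUp 𝒜 (M × M')) x) = (𝓖.proj n x.1, 𝓖'.proj n x.2) := by
      rw [LinearMap.add_apply, map_add]
      simp [Grading.coeff_coact]
    rw [h1]
    simp [Grading.coact_proj, ← map_add]

end Gradable

/-! ### Gradable modules give `P_N` of finite type. -/

section FiniteTypeOfGradable

variable {R : Type u} [Ring R] {𝒜 : ℤ → AddSubgroup R} [GradedRing 𝒜]
variable {N : Type v} [AddCommGroup N] [Module Rᵐᵒᵖ N] (𝓖 : Grading 𝒜 N)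

/-- The map `m eₙ ↦ mₙ₋ₖ eₙ₊ₐ`. -/
noncomputable def Grading.projShift (k d : ℤ) : PullUp 𝒜 N →ₗ[Rᵐᵒᵖ] PullUp 𝒜 N :=
  lift (fun n => (e 𝒜 (n + d)).comp (𝓖.proj (n - k))) fun j r hr n m => by
    have h1 : n + j - k = n - k + j := by ring
    simp only [AddMonoidHom.comp_apply]
    rw [h1, 𝓖.proj_op_smul hr, op_smul_e 𝒜 N hr, add_right_comm]

@[simp]
theorem Grading.projShift_e (k d n : ℤ) (m : N) :
    𝓖.projShift k d (e 𝒜 n m) = e 𝒜 (n + d) (𝓖.proj (n - k) m) := by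
  simp [projShift]

theorem hasFiniteType_pruferQuotient (𝓖 : Grading 𝒜 N) (hart : IsArtinianRing Rᵐᵒᵖ)
    (hbasic : IsBasic R) [Module.Finite Rᵐᵒᵖ N] : HasFiniteType Rᵐᵒᵖ (PruferQuotient 𝒜 N) := by
  classical
  obtain ⟨B, hB0, hB⟩ := 𝓖.exists_proj_eq_zero hart hbasic
  -- The `k`-th summand of `pN` consists of the `m eₙ` with `m` of degree `n - k`, so it lives in
  -- degrees `[k - B, k + B]`. For `k ≥ B` truncation does not touch it, and it can be moved down to
  -- position `B`; all summands then lie in degrees at most `2 * B`.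
  let c : ℤ → ℤ := fun k => min k B
  have hck : ∀ k, c k ≤ k := fun k => min_le_left _ _
  have hcB : ∀ k, c k ≤ B := fun k => min_le_right _ _
  let s₀ (k : ℤ) : PruferQuotient 𝒜 N →ₗ[Rᵐᵒᵖ] PruferQuotient 𝒜 N :=
    liftP ((negativePart 𝒜 N).mkQ ∘ₗ 𝓖.projShift k (c k - k)) fun n hn m => by
      have := hck k
      rw [LinearMap.comp_apply, Grading.projShift_e, mkQ_e, mk_of_neg (by omega)]
  have hs₀ : ∀ k n m, s₀ k (mk 𝒜 n m) = mk 𝒜 (n + (c k - k)) (𝓖.proj (n - k) m) := fun k n m => by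
    rw [liftP_mk, LinearMap.comp_apply, Grading.projShift_e, mkQ_e]
  let t₀ (k : ℤ) : PruferQuotient 𝒜 N →ₗ[Rᵐᵒᵖ] PruferQuotient 𝒜 N :=
    liftP ((negativePart 𝒜 N).mkQ ∘ₗ 𝓖.projShift (c k) (k - c k)) fun n hn m => by
      rw [LinearMap.comp_apply, Grading.projShift_e, mkQ_e]
      rcases le_or_gt k B with h | h
      · have : c k = k := min_eq_left h
        rw [mk_of_neg (by omega)]
      · have : c k = B := min_eq_right h.le
        rw [hB _ (by rw [lt_abs]; omega), map_zero]
  have ht₀ : ∀ k n m, t₀ k (mk 𝒜 n m) = mk 𝒜 (n + (k - c k)) (𝓖.proj (n - c k) m) :=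
    fun k n m => by
      rw [liftP_mk, LinearMap.comp_apply, Grading.projShift_e, mkQ_e]
  have hmem : ∀ k x, s₀ k x ∈ bounded 𝒜 N (B + B) := by
    intro k x
    induction x using PruferQuotient.induction_on with
    | zero => rw [map_zero]; exact zero_mem _
    | add x y hx hy => rw [map_add]; exact add_mem hx hy
    | mk n m =>
      rw [hs₀]
      by_cases h : B < |n - k|
      · rw [hB _ h, map_zero]; exact zero_mem _
      · rw [not_lt, abs_le] at h
        have := hcB k
        exact mk_mem_bounded (by omega) _
  refine .of_family (isFiniteLength_bounded hart hbasic (B + B)) (ι := ULift.{max u v} ℤ)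
    (fun k => (s₀ k.down).codRestrict _ (hmem k.down))
    (fun k => t₀ k.down ∘ₗ (bounded 𝒜 N (B + B)).subtype) fun x => ?_
  induction x using PruferQuotient.induction_on with
  | zero => exact ⟨∅, fun k _ => map_zero _, fun F' _ => by simp⟩
  | add x y hx hy =>
    obtain ⟨F, hF, hF'⟩ := hx
    obtain ⟨E, hE, hE'⟩ := hy
    refine ⟨F ∪ E, fun k hk => ?_, fun F' h => ?_⟩
    · rw [Finset.mem_union, not_or] at hk
      rw [map_add, hF k hk.1, hE k hk.2, add_zero]
    · simp_rw [map_add, Finset.sum_add_distrib]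
      rw [hF' F' (Finset.union_subset_left h), hE' F' (Finset.union_subset_right h)]
  | mk n m =>
    have hzero : ∀ k : ULift.{max u v} ℤ,
        k ∉ (Finset.Icc (n - B) (n + B)).image ULift.up → 𝓖.proj (n - k.down) m = 0 := by
      intro k hk
      refine hB _ ?_ _
      by_contra h
      rw [not_lt, abs_le] at h
      exact hk (Finset.mem_image.mpr ⟨k.down, Finset.mem_Icc.mpr ⟨by omega, by omega⟩, rfl⟩)
    refine ⟨(Finset.Icc (n - B) (n + B)).image ULift.up, fun k hk => ?_, fun F' h => ?_⟩
    · apply Subtype.ext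
      change s₀ k.down (mk 𝒜 n m) = 0
      rw [hs₀, hzero k hk, map_zero]
    · have h1 : ∀ k : ULift.{max u v} ℤ, t₀ k.down (s₀ k.down (mk 𝒜 n m)) =
          mk 𝒜 n (𝓖.proj (n - k.down) m) := by
        intro k
        have h2 : n + (c k.down - k.down) + (k.down - c k.down) = n := by ring
        have h3 : n + (c k.down - k.down) - c k.down = n - k.down := by ring
        rw [hs₀, ht₀, h2, h3, 𝓖.proj_proj_same]
      change ∑ k ∈ F', t₀ k.down (s₀ k.down (mk 𝒜 n m)) = _
      simp_rw [h1]
      rw [← map_sum]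
      congr 1
      have hinj : Function.Injective fun k : ULift.{max u v} ℤ => n - k.down := fun a b hab =>
        ULift.ext _ _ (sub_right_injective hab)
      have h4 := 𝓖.eq_sum_proj (x := m) (s := F'.image fun k => n - k.down) (by
        intro i hi
        by_contra hne
        have h5 : (ULift.up (n - i) : ULift.{max u v} ℤ) ∉ F' := fun h6 =>
          hi (Finset.mem_image.mpr ⟨_, h6, by simp⟩)
        refine hne ?_
        have := hzero (ULift.up (n - i)) fun h6 => h5 (h h6)
        simpa using this)
      rw [Finset.sum_image hinj.injOn] at h4
      exact h4.symm

end FiniteTypeOfGradable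

/-! ### Fitting's lemma, graded summands and the width of their supports. -/

section Fitting

variable {S : Type*} [Ring S] {P : Type*} [AddCommGroup P] [Module S P]

/-- Fitting's lemma for an endomorphism whose range has finite length. -/
theorem exists_isCompl_range_pow_ker_pow (c : Module.End S P)
    (hc : IsFiniteLength S (LinearMap.range c)) :
    ∃ m : ℕ, IsCompl (LinearMap.range (c ^ m)) (LinearMap.ker (c ^ m)) ∧
      IsFiniteLength S (LinearMap.range (c ^ m)) := by
  obtain ⟨hnoeth, hart⟩ := isFiniteLength_iff_isNoetherian_isArtinian.mp hc
  let c' : Module.End S (LinearMap.range c) := c.rangeRestrict ∘ₗ (LinearMap.range c).subtype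
  have hpow : ∀ (j : ℕ) (x : P), (c ^ (j + 1)) x = ((c' ^ j) (c.rangeRestrict x) : P) := by
    intro j
    induction j with
    | zero => intro x; simp
    | succ j ih =>
      intro x
      rw [pow_succ', Module.End.mul_apply, ih, pow_succ', Module.End.mul_apply]
      rfl
  have hrange : ∀ j : ℕ, LinearMap.range (c ^ (j + 1)) =
      (LinearMap.range (c' ^ j)).map (LinearMap.range c).subtype := by
    intro j
    ext y
    constructor
    · rintro ⟨x, rfl⟩
      exact ⟨_, ⟨c.rangeRestrict x, rfl⟩, (hpow j x).symm⟩
    · rintro ⟨_, ⟨⟨_, x, rfl⟩, rfl⟩, rfl⟩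
      exact ⟨x, hpow j x⟩
  obtain ⟨n, hn⟩ := IsArtinian.monotone_stabilizes c'.iterateRange
  have hstable : ∀ m, n ≤ m → LinearMap.range (c ^ (n + 1)) = LinearMap.range (c ^ (m + 1)) := by
    intro m hm
    rw [hrange, hrange]
    exact congrArg _ (hn m hm)
  have hdouble : LinearMap.range (c ^ (n + 1)) = LinearMap.range (c ^ ((n + 1) + (n + 1))) :=
    hstable (n + 1 + n) (by omega)
  have hle : LinearMap.range (c ^ (n + 1)) ≤ LinearMap.range c := by
    rintro _ ⟨x, rfl⟩
    rw [pow_succ', Module.End.mul_apply]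
    exact ⟨_, rfl⟩
  have hfin : IsFiniteLength S (LinearMap.range (c ^ (n + 1))) :=
    hc.of_injective (Submodule.inclusion_injective hle)
  refine ⟨n + 1, ⟨?_, ?_⟩, hfin⟩
  · obtain ⟨hnoeth', -⟩ := isFiniteLength_iff_isNoetherian_isArtinian.mp hfin
    let g : Module.End S (LinearMap.range (c ^ (n + 1))) :=
      (c ^ (n + 1)).rangeRestrict ∘ₗ (LinearMap.range (c ^ (n + 1))).subtype
    have hg : Function.Surjective g := by
      rintro ⟨y, hy⟩
      rw [hdouble] at hy
      obtain ⟨x, rfl⟩ := hy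
      refine ⟨⟨(c ^ (n + 1)) x, x, rfl⟩, Subtype.ext ?_⟩
      change (c ^ (n + 1)) ((c ^ (n + 1)) x) = (c ^ ((n + 1) + (n + 1))) x
      rw [pow_add c (n + 1) (n + 1), Module.End.mul_apply]
    have hinj := (IsNoetherian.bijective_of_surjective_endomorphism g hg).1
    rw [Submodule.disjoint_def]
    intro y hy hy'
    have := @hinj ⟨y, hy⟩ 0 (Subtype.ext (by rw [map_zero]; exact hy'))
    exact congrArg Subtype.val this
  · rw [codisjoint_iff, Submodule.eq_top_iff']
    intro x
    obtain ⟨z, hz⟩ : (c ^ (n + 1)) x ∈ LinearMap.range (c ^ ((n + 1) + (n + 1))) :=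
      hdouble ▸ ⟨x, rfl⟩
    refine Submodule.mem_sup.mpr ⟨(c ^ (n + 1)) z, ⟨z, rfl⟩, x - (c ^ (n + 1)) z, ?_, by abel⟩
    rw [LinearMap.mem_ker, map_sub, ← hz, pow_add, Module.End.mul_apply, sub_self]

end Fitting

namespace Grading

variable {R : Type u} [Ring R] {𝒜 : ℤ → AddSubgroup R} [GradedRing 𝒜]

section

variable {K : Type*} [AddCommGroup K] [Module Rᵐᵒᵖ K] (𝓚 : Grading 𝒜 K)
variable {M : Type*} [AddCommGroup M] [Module Rᵐᵒᵖ M] (𝓖 : Grading 𝒜 M)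
variable {M' : Type*} [AddCommGroup M'] [Module Rᵐᵒᵖ M'] (𝓖' : Grading 𝒜 M')

/-- `K` is a direct summand of `M` as a graded module. -/
def IsRetract : Prop :=
  ∃ (i : K →ₗ[Rᵐᵒᵖ] M) (p : M →ₗ[Rᵐᵒᵖ] K), IsHomogeneousMap 𝓚 𝓖 0 i ∧
    IsHomogeneousMap 𝓖 𝓚 0 p ∧ ∀ x, p (i x) = x

variable {𝓚 𝓖 𝓖'} in
theorem IsRetract.trans (h : IsRetract 𝓚 𝓖) (h' : IsRetract 𝓖 𝓖') : IsRetract 𝓚 𝓖' := by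
  obtain ⟨i, p, hi, hp, hpi⟩ := h
  obtain ⟨i', p', hi', hp', hpi'⟩ := h'
  exact ⟨i' ∘ₗ i, p ∘ₗ p', hi'.comp_zero hi, hp.comp_zero hp', fun x => by simp [hpi, hpi']⟩

theorem exists_isRetract_of_isCompl {A B : Submodule Rᵐᵒᵖ M} (hA : 𝓖.IsHomogeneousSubmodule A)
    (hB : 𝓖.IsHomogeneousSubmodule B) (hAB : IsCompl A B) :
    ∃ 𝓚 : Grading 𝒜 A, IsRetract 𝓚 𝓖 ∧ ∀ n (x : A), (𝓚.proj n x : M) = 𝓖.proj n x := by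
  have hpi : ∀ x : A, A.projectionOnto B hAB (A.subtype x) = x := by simp
  have h := 𝓖.isHomogeneousMap_of_isCompl hA hB hAB
  exact ⟨𝓖.ofRetract _ _ hpi h, ⟨A.subtype, A.projectionOnto B hAB, 𝓖.ofRetract_incl _ _ hpi h,
    𝓖.ofRetract_retr _ _ hpi h, hpi⟩,
    fun n x => ((𝓖.ofRetract_incl _ _ hpi h).proj_apply n x).symm⟩

end

theorem exists_isIndecomposable {K : Type v} [AddCommGroup K] [Module Rᵐᵒᵖ K] (𝓚 : Grading 𝒜 K)
    (hK : IsFiniteLength Rᵐᵒᵖ K) (n : ℤ) (hn : ∃ y, 𝓚.proj n y ≠ 0) :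
    ∃ (K' : Type v) (_ : AddCommGroup K') (_ : Module Rᵐᵒᵖ K') (𝓚' : Grading 𝒜 K'),
      IsRetract 𝓚' 𝓚 ∧ 𝓚'.IsIndecomposable ∧ IsFiniteLength Rᵐᵒᵖ K' ∧ ∃ y, 𝓚'.proj n y ≠ 0 := by
  obtain ⟨ℓ, hℓ⟩ := ENat.ne_top_iff_exists.mp (Module.length_ne_top_iff.mpr hK)
  induction ℓ using Nat.strong_induction_on generalizing K with
  | _ ℓ ih =>
    by_cases hind : 𝓚.IsIndecomposable
    · exact ⟨K, _, _, 𝓚, ⟨LinearMap.id, LinearMap.id, fun n x => by simp, fun n x => by simp,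
        fun x => rfl⟩, hind, hK, hn⟩
    obtain ⟨A, B, hA, hB, hAB, hA0, hB0⟩ : ∃ A B : Submodule Rᵐᵒᵖ K,
        𝓚.IsHomogeneousSubmodule A ∧ 𝓚.IsHomogeneousSubmodule B ∧ IsCompl A B ∧
          A ≠ ⊥ ∧ B ≠ ⊥ := by
      simpa only [IsIndecomposable, not_forall, not_or, exists_prop] using hind
    obtain ⟨hnoeth, hart⟩ := isFiniteLength_iff_isNoetherian_isArtinian.mp hK
    have step : ∀ A B : Submodule Rᵐᵒᵖ K, 𝓚.IsHomogeneousSubmodule A →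
        𝓚.IsHomogeneousSubmodule B → IsCompl A B → B ≠ ⊥ → (∃ y ∈ A, 𝓚.proj n y ≠ 0) →
        ∃ (K' : Type v) (_ : AddCommGroup K') (_ : Module Rᵐᵒᵖ K') (𝓚' : Grading 𝒜 K'),
          IsRetract 𝓚' 𝓚 ∧ 𝓚'.IsIndecomposable ∧ IsFiniteLength Rᵐᵒᵖ K' ∧
            ∃ y, 𝓚'.proj n y ≠ 0 := by
      intro A B hA hB hAB hB0 hy
      obtain ⟨y, hyA, hy⟩ := hy
      obtain ⟨𝓐, hr, hproj⟩ := 𝓚.exists_isRetract_of_isCompl hA hB hAB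
      have hAtop : A ≠ ⊤ := by
        rintro rfl
        exact hB0 (eq_bot_of_top_isCompl hAB)
      have hAfin := hK.of_injective A.subtype_injective
      obtain ⟨ℓ', hℓ'⟩ := ENat.ne_top_iff_exists.mp (Module.length_ne_top_iff.mpr hAfin)
      have hlt := Submodule.length_lt hAtop
      rw [← hℓ, ← hℓ'] at hlt
      obtain ⟨K', _, _, 𝓚', h1, h2⟩ := ih ℓ' (by exact_mod_cast hlt) 𝓐 hAfin
        ⟨⟨y, hyA⟩, fun h => hy (by rw [← hproj n ⟨y, hyA⟩, h]; rfl)⟩ hℓ'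
      exact ⟨K', _, _, 𝓚', h1.trans hr, h2⟩
    obtain ⟨y, hy⟩ := hn
    obtain ⟨a, ha, b, hb, rfl⟩ : ∃ a ∈ A, ∃ b ∈ B, a + b = y :=
      Submodule.mem_sup.mp (hAB.sup_eq_top ▸ Submodule.mem_top)
    by_cases ha0 : 𝓚.proj n a = 0
    · refine step B A hB hA hAB.symm hA0 ⟨b, hb, fun hb0 => hy ?_⟩
      rw [map_add, ha0, hb0, add_zero]
    · exact step A B hA hB hAB hB0 ⟨a, ha, ha0⟩

theorem exists_isRetract_of_fixed {M : Type v} [AddCommGroup M] [Module Rᵐᵒᵖ M] (𝓖 : Grading 𝒜 M)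
    {c : Module.End Rᵐᵒᵖ M} (hc : IsHomogeneousMap 𝓖 𝓖 0 c)
    (hfin : IsFiniteLength Rᵐᵒᵖ (LinearMap.range c)) {n : ℤ} {x : M} (hx : c x = x)
    (hxn : 𝓖.proj n x ≠ 0) :
    ∃ (K : Type v) (_ : AddCommGroup K) (_ : Module Rᵐᵒᵖ K) (𝓚 : Grading 𝒜 K),
      IsRetract 𝓚 𝓖 ∧ 𝓚.IsIndecomposable ∧ IsFiniteLength Rᵐᵒᵖ K ∧ ∃ y, 𝓚.proj n y ≠ 0 := by
  obtain ⟨m, hcompl, hm⟩ := exists_isCompl_range_pow_ker_pow c hfin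
  have hpow : ∀ m : ℕ, IsHomogeneousMap 𝓖 𝓖 0 (c ^ m) := by
    intro m
    induction m with
    | zero => intro n x; simp
    | succ m ih => rw [pow_succ]; exact ih.comp_zero hc
  have hxm : ∀ m : ℕ, (c ^ m) x = x := by
    intro m
    induction m with
    | zero => rfl
    | succ m ih => rw [pow_succ, Module.End.mul_apply, hx, ih]
  obtain ⟨𝓐, hr, hproj⟩ := 𝓖.exists_isRetract_of_isCompl (hpow m).range (hpow m).ker hcompl
  obtain ⟨K, _, _, 𝓚, h1, h2⟩ := 𝓐.exists_isIndecomposable hm n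
    ⟨⟨x, x, hxm m⟩, fun h => hxn (by rw [← hproj n ⟨x, x, hxm m⟩, h]; rfl)⟩
  exact ⟨K, _, _, 𝓚, h1.trans hr, h2⟩

section Support

variable {K : Type*} [AddCommGroup K] [Module Rᵐᵒᵖ K] (𝓚 : Grading 𝒜 K)

/-- The submodule generated by the homogeneous elements of degree at least `c`. -/
def upper (c : ℤ) : Submodule Rᵐᵒᵖ K := Submodule.span Rᵐᵒᵖ {x | ∃ m, c ≤ m ∧ 𝓚.proj m x = x}

theorem upper_anti {c c' : ℤ} (h : c ≤ c') : 𝓚.upper c' ≤ 𝓚.upper c :=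
  Submodule.span_mono fun _ ⟨m, hm, hx⟩ => ⟨m, h.trans hm, hx⟩

theorem proj_op_smul' {j : ℤ} {r : R} (hr : r ∈ 𝒜 j) (n : ℤ) (x : K) :
    𝓚.proj n (op r • x) = op r • 𝓚.proj (n - j) x := by
  rw [← 𝓚.proj_op_smul hr, sub_add_cancel]

theorem proj_eq_zero_of_mem_upper {L : ℤ} (hL : ∀ j : ℤ, L ≤ |j| → ∀ r ∈ 𝒜 j, r = 0)
    {c d : ℤ} (hd : d ≤ c - L) {x : K} (hx : x ∈ 𝓚.upper c) :
    𝓚.proj d x = 0 := by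
  -- Quantifying over `r` makes the claim stable under the action, as span induction needs.
  suffices h : ∀ r : R, 𝓚.proj d (op r • x) = 0 by simpa using h 1
  induction hx using Submodule.span_induction with
  | mem x h =>
    obtain ⟨m, hm, hx⟩ := h
    intro r
    induction r using DirectSum.Decomposition.inductionOn 𝒜 with
    | zero => simp
    | add a b ha hb => rw [op_add, add_smul, map_add, ha, hb, add_zero]
    | @homogeneous j a =>
      rw [𝓚.proj_op_smul' a.2, ← hx]
      by_cases h : m = d - j
      · rw [hL j (by have := neg_le_abs j; omega) a a.2, op_zero, zero_smul]
      · rw [𝓚.proj_proj_of_ne h, smul_zero]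
  | zero => simp
  | add x y _ _ hx hy => intro r; rw [smul_add, map_add, hx, hy, add_zero]
  | smul s x _ hx =>
    intro r
    have := hx (s.unop * r)
    rwa [op_mul, op_unop, mul_smul] at this

variable {𝓚} in
-- If going down from `c` to `c - 2 * L` brings nothing new, the components in degrees `[c - 2 * L,
-- c - L]` vanish. No ring element jumps this gap, so `K` splits into the parts above (`A`) and
-- below (`B`) it, and degree `n` lies above.
theorem IsIndecomposable.proj_eq_zero_of_upper_le {L : ℤ} (hL : ∀ j : ℤ, L ≤ |j| → ∀ r ∈ 𝒜 j, r = 0)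
    (h𝓚 : 𝓚.IsIndecomposable) (hL0 : 0 < L) {n c : ℤ} (hn : ∃ y, 𝓚.proj n y ≠ 0)
    (hcn : c ≤ n) (hc : 𝓚.upper (c - 2 * L) ≤ 𝓚.upper c) {m : ℤ}
    (hm : m < c - 2 * L) (x : K) : 𝓚.proj m x = 0 := by
  have hwindow : ∀ d, c - 2 * L ≤ d → d ≤ c - L → ∀ x, 𝓚.proj d x = 0 := by
    intro d h1 h2 x
    rw [← 𝓚.proj_proj_same]
    exact 𝓚.proj_eq_zero_of_mem_upper hL h2
      (hc (Submodule.subset_span ⟨d, h1, 𝓚.proj_proj_same d x⟩))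
  have hsmul : ∀ (p : ℤ → Prop), (∀ (x : K), (∀ d, p d → 𝓚.proj d x = 0) → ∀ j, ∀ r ∈ 𝒜 j,
      ∀ d, p d → 𝓚.proj d (op r • x) = 0) → ∀ (s : Rᵐᵒᵖ) (x : K),
      (∀ d, p d → 𝓚.proj d x = 0) → ∀ d, p d → 𝓚.proj d (s • x) = 0 := by
    intro p h s x hx d hd
    obtain ⟨r, rfl⟩ := op_surjective s
    induction r using DirectSum.Decomposition.inductionOn 𝒜 with
    | zero => simp
    | add a b ha hb => rw [op_add, add_smul, map_add, ha, hb, add_zero]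
    | @homogeneous j a => exact h x hx j a a.2 d hd
  let A : Submodule Rᵐᵒᵖ K :=
    { carrier := {x | ∀ d, d ≤ c - L → 𝓚.proj d x = 0}
      zero_mem' := fun d _ => map_zero _
      add_mem' := fun hx hy d hd => by rw [map_add, hx d hd, hy d hd, add_zero]
      smul_mem' := fun s x hx => hsmul (fun d => d ≤ c - L) (fun x hx j r hr d hd => by
        by_cases h1 : c - 2 * L ≤ d
        · exact hwindow d h1 hd _
        rw [𝓚.proj_op_smul' hr]
        by_cases h2 : d - j ≤ c - L
        · rw [hx _ h2, smul_zero]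
        · rw [hL j (by have := neg_le_abs j; omega) r hr, op_zero, zero_smul]) s x hx }
  let B : Submodule Rᵐᵒᵖ K :=
    { carrier := {x | ∀ d, c - 2 * L ≤ d → 𝓚.proj d x = 0}
      zero_mem' := fun d _ => map_zero _
      add_mem' := fun hx hy d hd => by rw [map_add, hx d hd, hy d hd, add_zero]
      smul_mem' := fun s x hx => hsmul (fun d => c - 2 * L ≤ d) (fun x hx j r hr d hd => by
        by_cases h1 : d ≤ c - L
        · exact hwindow d hd h1 _
        rw [𝓚.proj_op_smul' hr]
        by_cases h2 : c - 2 * L ≤ d - j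
        · rw [hx _ h2, smul_zero]
        · rw [hL j (by have := le_abs_self j; omega) r hr, op_zero, zero_smul]) s x hx }
  have hproj : ∀ x n d, n ≠ d ∨ 𝓚.proj n x = 0 → 𝓚.proj d (𝓚.proj n x) = 0 := by
    rintro x n d (h | h)
    · exact 𝓚.proj_proj_of_ne h x
    · rw [h, map_zero]
  have hA : ∀ n x, c - 2 * L ≤ n → 𝓚.proj n x ∈ A := by
    intro n x hn d hd
    refine hproj x n d ?_
    by_cases h : n = d
    · exact Or.inr (hwindow n hn (h ▸ hd) x)
    · exact Or.inl h
  have hB : ∀ n x, n ≤ c - L → 𝓚.proj n x ∈ B := by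
    intro n x hn d hd
    refine hproj x n d ?_
    by_cases h : n = d
    · exact Or.inr (hwindow n (h ▸ hd) hn x)
    · exact Or.inl h
  have hcompl : IsCompl A B := by
    constructor
    · rw [Submodule.disjoint_def]
      intro x hxA hxB
      refine 𝓚.ext_proj fun d => ?_
      rw [map_zero]
      rcases le_total d (c - L) with h | h
      · exact hxA d h
      · exact hxB d (by omega)
    · rw [codisjoint_iff, Submodule.eq_top_iff']
      intro x
      rw [𝓚.eq_sum_proj (x := x) (s := (𝓚.finite_proj_ne_zero x).toFinset) (by simp)]
      refine sum_mem fun n _ => ?_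
      rcases le_total n (c - L) with h | h
      · exact Submodule.mem_sup_right (hB n x h)
      · exact Submodule.mem_sup_left (hA n x (by omega))
  have hhom : ∀ (p : ℤ → Prop) (x : K), (∀ d, p d → 𝓚.proj d x = 0) → ∀ n d, p d →
      𝓚.proj d (𝓚.proj n x) = 0 := by
    intro p x hx n d hd
    refine hproj x n d ?_
    by_cases h : n = d
    · exact Or.inr (hx n (h ▸ hd))
    · exact Or.inl h
  rcases h𝓚 A B (fun x hx n => hhom _ x hx n) (fun x hx n => hhom _ x hx n) hcompl with h | h
  · obtain ⟨y, hy⟩ := hn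
    have := hA n y (by omega)
    rw [h, Submodule.mem_bot] at this
    exact absurd this hy
  · have := hB m x (by omega)
    rwa [h, Submodule.mem_bot] at this

variable {𝓚} in
/-- The degrees of an indecomposable graded module of length at most `ℓ` are close together. -/
theorem IsIndecomposable.proj_eq_zero_of_length_le [IsArtinian Rᵐᵒᵖ K] [IsNoetherian Rᵐᵒᵖ K]
    {L : ℤ} (hL : ∀ j : ℤ, L ≤ |j| → ∀ r ∈ 𝒜 j, r = 0)
    (h𝓚 : 𝓚.IsIndecomposable) (hL0 : 0 < L) {n : ℤ} (hn : ∃ y, 𝓚.proj n y ≠ 0) {ℓ : ℕ}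
    (hℓ : Module.length Rᵐᵒᵖ K ≤ ℓ) {m : ℤ} (hm : m < n - 2 * L * (ℓ + 1)) (x : K) :
    𝓚.proj m x = 0 := by
  -- The submodules `upper (n - 2 * L * i)` increase with `i`, and length at most `ℓ` does not allow
  -- `ℓ + 1` strict steps.
  obtain ⟨i, hi, hle⟩ : ∃ i ≤ ℓ,
      𝓚.upper (n - 2 * L * i - 2 * L) ≤ 𝓚.upper (n - 2 * L * i) := by
    by_contra! h
    have key : ∀ i ≤ ℓ + 1, (i : ℕ∞) ≤ Module.length Rᵐᵒᵖ (𝓚.upper (n - 2 * L * i)) := by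
      intro i
      induction i with
      | zero => intro _; exact bot_le
      | succ i ih =>
        intro hi
        have h1 := Submodule.height_strictMono (lt_of_le_not_ge
          (𝓚.upper_anti (show n - 2 * L * i - 2 * L ≤ n - 2 * L * i by omega)) (h i (by omega)))
        rw [← Module.length_submodule, ← Module.length_submodule] at h1
        have h2 : n - 2 * L * (i + 1 : ℕ) = n - 2 * L * i - 2 * L := by push_cast; ring
        rw [h2, Nat.cast_succ]
        exact Order.add_one_le_of_lt ((ih (by omega)).trans_lt h1)
    have h1 := ((key (ℓ + 1) le_rfl).trans
      (Module.length_le_of_injective _ (Submodule.subtype_injective _))).trans hℓ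
    norm_cast at h1
    omega
  refine h𝓚.proj_eq_zero_of_upper_le hL hL0 hn (c := n - 2 * L * i) (by
    have : 0 ≤ 2 * L * (i : ℤ) := by positivity
    omega) hle ?_ x
  refine hm.trans_le ?_
  have h1 : 2 * L * (i : ℤ) ≤ 2 * L * ℓ :=
    mul_le_mul_of_nonneg_left (by exact_mod_cast hi) (by omega)
  rw [mul_add]
  omega

end Support

end Grading

section FinsuppRetract

variable {S : Type*} [Ring S] {M : Type*} [AddCommGroup M] [Module S M] {X : Type*}
  [AddCommGroup X] [Module S X] {ι : Type*}

theorem exists_finset_sum_single_eq [DecidableEq ι] (s : M →ₗ[S] ι →₀ X) (T : Finset M) :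
    ∃ F : Finset ι, ∀ y ∈ T, ∑ i ∈ F, Finsupp.single i (s y i) = s y := by
  classical
  refine ⟨T.biUnion fun y => (s y).support, fun y hy => ?_⟩
  have hsub : (s y).support ⊆ T.biUnion fun y => (s y).support :=
    Finset.subset_biUnion_of_mem (fun y => (s y).support) hy
  rw [← Finset.sum_subset hsub]
  · exact (s y).sum_single
  · intro i _ hi
    rw [Finsupp.notMem_support_iff.mp hi, Finsupp.single_zero]

end FinsuppRetract

variable {R : Type u} [Ring R] {𝒜 : ℤ → AddSubgroup R} [GradedRing 𝒜]

/-! ### A gradable summand of `N` from finite type of `P_N`. -/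

section Summand

variable {N : Type v} [AddCommGroup N] [Module Rᵐᵒᵖ N]

theorem bounded_isHomogeneousSubmodule (d : ℤ) :
    (pruferGrading 𝒜 N).IsHomogeneousSubmodule (bounded 𝒜 N d) := by
  intro x hx
  induction hx using Submodule.span_induction with
  | mem x h =>
    obtain ⟨k, hk, m, rfl⟩ := h
    intro n
    rw [pruferGrading_proj_mk]
    split_ifs with h
    · exact mk_mem_bounded hk m
    · exact zero_mem _
  | zero => intro n; rw [map_zero]; exact zero_mem _
  | add x y _ _ hx hy => intro n; rw [map_add]; exact add_mem (hx n) (hy n)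
  | smul s x _ hx =>
    obtain ⟨r, rfl⟩ := op_surjective s
    induction r using DirectSum.Decomposition.inductionOn 𝒜 with
    | zero => intro n; rw [op_zero, zero_smul, map_zero]; exact zero_mem _
    | add a b ha hb => intro n; rw [op_add, add_smul, map_add]; exact add_mem (ha n) (hb n)
    | @homogeneous j a =>
      intro n
      rw [Grading.proj_op_smul' _ a.2]
      exact Submodule.smul_mem _ _ (hx _)

theorem exists_le_bounded {V : Submodule Rᵐᵒᵖ (PruferQuotient 𝒜 N)} (hV : V.FG) :
    ∃ d : ℤ, V ≤ bounded 𝒜 N d := by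
  obtain ⟨T, rfl⟩ := hV
  choose d hd using exists_mem_bounded (𝒜 := 𝒜) (N := N)
  refine ⟨(T.sup d : ℕ), Submodule.span_le.mpr fun x hx => ?_⟩
  exact bounded_mono (by exact_mod_cast Finset.le_sup (f := d) hx) (hd x)

/-- If `P_N` has finite type then, in every large enough degree, `P_N` has an indecomposable
graded summand of finite length that is nonzero in that degree. -/
theorem exists_isRetract_pruferGrading (hart : IsArtinianRing Rᵐᵒᵖ) (hbasic : IsBasic R)
    [Module.Finite Rᵐᵒᵖ N] [Nontrivial N] {X : Type*} [AddCommGroup X] [Module Rᵐᵒᵖ X]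
    (hX : IsFiniteLength Rᵐᵒᵖ X) {ι : Type*} (s : PruferQuotient 𝒜 N →ₗ[Rᵐᵒᵖ] ι →₀ X)
    (t : (ι →₀ X) →ₗ[Rᵐᵒᵖ] PruferQuotient 𝒜 N) (hts : ∀ x, t (s x) = x)
    {L : ℤ} (hL : ∀ j : ℤ, L ≤ |j| → ∀ r ∈ 𝒜 j, r = 0) {n : ℤ} (hn : L ≤ n) :
    ∃ (K : Type v) (_ : AddCommGroup K) (_ : Module Rᵐᵒᵖ K) (𝓚 : Grading 𝒜 K),
      𝓚.IsRetract (pruferGrading 𝒜 N) ∧ 𝓚.IsIndecomposable ∧ IsFiniteLength Rᵐᵒᵖ K ∧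
        ∃ y, 𝓚.proj n y ≠ 0 := by
  classical
  obtain ⟨T, hT⟩ := exists_finset_closure_eq_top 𝒜 hart hbasic N
  obtain ⟨F, hF⟩ := exists_finset_sum_single_eq s (T.image (mk 𝒜 n))
  obtain ⟨hXn, hXa⟩ := isFiniteLength_iff_isNoetherian_isArtinian.mp hX
  -- A finite piece of the identity `t ∘ s`: it fixes the degree `n` component, which is finitely
  -- generated over `R₀`, and its range is finitely generated.
  let h : Module.End Rᵐᵒᵖ (PruferQuotient 𝒜 N) :=
    ∑ i ∈ F, (t ∘ₗ Finsupp.lsingle i) ∘ₗ Finsupp.lapply i ∘ₗ s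
  have hh : ∀ x, h x = t (∑ i ∈ F, Finsupp.single i (s x i)) := fun x => by
    simp [h, LinearMap.sum_apply]
  have hmk : ∀ m, h (mk 𝒜 n m) = mk 𝒜 n m := fun m =>
    mk_mem_of_forall (W := LinearMap.eqLocus h LinearMap.id) hT (fun x hx => by
      rw [LinearMap.mem_eqLocus, hh, hF _ (Finset.mem_image_of_mem _ hx), hts]; rfl) m
  let V : Submodule Rᵐᵒᵖ (PruferQuotient 𝒜 N) :=
    F.sup fun i => LinearMap.range (t ∘ₗ Finsupp.lsingle i)
  have hV : V.FG := Submodule.fg_finset_sup _ _ fun i _ => by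
    rw [LinearMap.range_eq_map]
    exact (IsNoetherian.noetherian ⊤).map _
  have hhV : ∀ x, h x ∈ V := fun x => by
    rw [LinearMap.sum_apply]
    exact sum_mem fun i hi => Finset.le_sup (f := fun i => LinearMap.range (t ∘ₗ Finsupp.lsingle i))
      hi ⟨_, rfl⟩
  obtain ⟨d, hd⟩ := exists_le_bounded hV
  let 𝓖 := pruferGrading 𝒜 N
  -- The degree zero part still fixes degree `n`, and its range stays in the homogeneous submodule
  -- `bounded 𝒜 N d` of finite length, so Fitting's lemma applies.
  let c := 𝓖.part 𝓖 0 h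
  have hc : ∀ k m, c (mk 𝒜 k m) = 𝓖.proj k (h (mk 𝒜 k m)) := fun k m => by
    have := 𝓖.part_of_proj_eq 𝓖 (d := 0) h (n := k) (x := mk 𝒜 k m)
      (by rw [pruferGrading_proj_mk, if_pos rfl])
    rwa [add_zero] at this
  have hcd : LinearMap.range c ≤ bounded 𝒜 N d := by
    rintro _ ⟨x, rfl⟩
    induction x using PruferQuotient.induction_on with
    | zero => rw [map_zero]; exact zero_mem _
    | add x y hx hy => rw [map_add]; exact add_mem hx hy
    | mk k m => rw [hc]; exact bounded_isHomogeneousSubmodule d _ (hd (hhV _)) k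
  obtain ⟨m, hm⟩ := exists_ne (0 : N)
  have hcm : c (mk 𝒜 n m) = mk 𝒜 n m := by
    rw [hc, hmk, pruferGrading_proj_mk, if_pos rfl]
  refine 𝓖.exists_isRetract_of_fixed (𝓖.part_isHomogeneousMap 𝓖 0 h)
    ((isFiniteLength_bounded hart hbasic d).of_injective (Submodule.inclusion_injective hcd))
    hcm ?_
  rw [pruferGrading_proj_mk, if_pos rfl, ne_eq, mk_eq_zero_iff,
    degreeImage_eq_bot 𝒜 N hL (by omega)]
  exact hm

/-- The identity of `K` is a finite sum of endomorphisms factoring through `X`. One of them is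
bijective, so `K` embeds in `X`. -/
theorem Grading.IsIndecomposable.length_le (hart : IsArtinianRing Rᵐᵒᵖ) (hbasic : IsBasic R)
    {K : Type*} [AddCommGroup K] [Module Rᵐᵒᵖ K] {𝓚 : Grading 𝒜 K} (h𝓚 : 𝓚.IsIndecomposable)
    [Nontrivial K] (hK : IsFiniteLength Rᵐᵒᵖ K) {X : Type*} [AddCommGroup X] [Module Rᵐᵒᵖ X]
    {ι : Type*} (s : K →ₗ[Rᵐᵒᵖ] ι →₀ X) (t : (ι →₀ X) →ₗ[Rᵐᵒᵖ] K) (hts : ∀ x, t (s x) = x) :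
    Module.length Rᵐᵒᵖ K ≤ Module.length Rᵐᵒᵖ X := by
  classical
  obtain ⟨hKn, hKa⟩ := isFiniteLength_iff_isNoetherian_isArtinian.mp hK
  obtain ⟨B, -, hB⟩ := 𝓚.exists_proj_eq_zero hart hbasic
  obtain ⟨T, hT⟩ := IsNoetherian.noetherian (⊤ : Submodule Rᵐᵒᵖ K)
  obtain ⟨F, hF⟩ := exists_finset_sum_single_eq s T
  obtain ⟨i, -, hi⟩ := h𝓚.exists_bijective_of_sum_eq_one hB F
    (fun i => (t ∘ₗ Finsupp.lsingle i) ∘ₗ Finsupp.lapply i ∘ₗ s) (by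
      refine LinearMap.ext_on hT fun y hy => ?_
      have h1 : (∑ i ∈ F, (t ∘ₗ Finsupp.lsingle i) ∘ₗ Finsupp.lapply i ∘ₗ s :
          Module.End Rᵐᵒᵖ K) y = t (∑ i ∈ F, Finsupp.single i (s y i)) := by
        simp [LinearMap.sum_apply]
      rw [h1, hF y hy, hts]; rfl)
  have h1 : Function.Injective (Finsupp.lapply i ∘ₗ s : K →ₗ[Rᵐᵒᵖ] X) := by
    have := hi.1
    rw [LinearMap.coe_comp] at this
    exact this.of_comp
  exact Module.length_le_of_injective _ h1

theorem mk_injective {L : ℤ} (hL : ∀ j : ℤ, L ≤ |j| → ∀ r ∈ 𝒜 j, r = 0) {n : ℤ} (hn : L ≤ n) :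
    Function.Injective (mk 𝒜 n : N →+ PruferQuotient 𝒜 N) := by
  rw [injective_iff_map_eq_zero]
  intro m hm
  rwa [mk_eq_zero_iff, degreeImage_eq_bot 𝒜 N hL (by omega)] at hm

/-- Graded maps into `P_N` from graded modules concentrated in high degrees lift to `pN`. -/
theorem exists_lift {L : ℤ} (hL0 : 0 < L) (hL : ∀ j : ℤ, L ≤ |j| → ∀ r ∈ 𝒜 j, r = 0)
    {K : Type*} [AddCommGroup K] [Module Rᵐᵒᵖ K] (𝓚 : Grading 𝒜 K)
    (hK : ∀ n < 2 * L, ∀ x, 𝓚.proj n x = 0) {i : K →ₗ[Rᵐᵒᵖ] PruferQuotient 𝒜 N}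
    (hi : 𝓚.IsHomogeneousMap (pruferGrading 𝒜 N) 0 i) :
    ∃ g : PullUp 𝒜 K →ₗ[Rᵐᵒᵖ] PullUp 𝒜 N, ∀ n x, ∃ m, g (e 𝒜 n x) = e 𝒜 n m ∧
      mk 𝒜 n m = i (𝓚.proj n x) := by
  classical
  have hex : ∀ n x, ∃ m, i (𝓚.proj n x) = mk 𝒜 n m := fun n x =>
    exists_mk_of_proj_eq (by rw [hi.proj_apply, 𝓚.proj_proj_same])
  choose τ hτ using hex
  let f : ℤ → K →+ N := fun n => if h : 2 * L ≤ n then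
    AddMonoidHom.mk' (τ n) fun x y => mk_injective hL (show L ≤ n by omega) (by
      rw [map_add, ← hτ, ← hτ, ← hτ, map_add, map_add]) else 0
  have hf : ∀ n x, mk 𝒜 n (f n x) = i (𝓚.proj n x) := by
    intro n x
    by_cases h : 2 * L ≤ n
    · simp only [f, dif_pos h, AddMonoidHom.mk'_apply, ← hτ]
    · simp only [f, dif_neg h]
      rw [hK n (by omega), AddMonoidHom.zero_apply, map_zero, map_zero]
  have hf0 : ∀ n < 2 * L, f n = 0 := fun n hn => dif_neg (by omega)
  refine ⟨lift (fun n => (e 𝒜 n).comp (f n)) fun j r hr n m => ?_, fun n x =>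
    ⟨f n x, by simp, hf n x⟩⟩
  simp only [AddMonoidHom.comp_apply]
  rw [op_smul_e 𝒜 N hr]
  congr 1
  -- Compatibility can be tested in `P_N` when `n + j ≥ L`. Below that, either `n < 2 * L` and both
  -- sides are zero, or `j < -L` and `r = 0`.
  by_cases hn : L ≤ n + j
  · refine mk_injective hL hn ?_
    rw [hf, ← op_smul_mk hr, hf, 𝓚.proj_op_smul hr, map_smul]
  · rw [hf0 _ (by omega), AddMonoidHom.zero_apply]
    by_cases hn' : n < 2 * L
    · rw [hf0 n hn', AddMonoidHom.zero_apply, smul_zero]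
    · rw [hL j (by have := neg_le_abs j; omega) r hr, op_zero, zero_smul]

/-- The map is `m ↦ ∑ₙ p (m eₙ)`, a finite sum because `K` has bounded support. It is linear because
a ring element of degree `j` merely reindexes the sum by `j`. -/
theorem exists_sum_mk {K : Type*} [AddCommGroup K] [Module Rᵐᵒᵖ K] (𝓚 : Grading 𝒜 K) {B : ℤ}
    (hB : ∀ n : ℤ, B < |n| → ∀ x, 𝓚.proj n x = 0) {p : PruferQuotient 𝒜 N →ₗ[Rᵐᵒᵖ] K}
    (hp : (pruferGrading 𝒜 N).IsHomogeneousMap 𝓚 0 p) :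
    ∃ v : N →ₗ[Rᵐᵒᵖ] K, ∀ n m, 𝓚.proj n (v m) = p (mk 𝒜 n m) := by
  have hproj : ∀ k n m, 𝓚.proj k (p (mk 𝒜 n m)) = if n = k then p (mk 𝒜 n m) else 0 := by
    intro k n m
    rw [hp.proj_apply, pruferGrading_proj_mk]
    split_ifs <;> simp
  have hzero : ∀ n m, B < |n| → p (mk 𝒜 n m) = 0 := fun n m hn => by
    have := hproj n n m
    rw [hB n hn, if_pos rfl] at this
    exact this.symm
  have hfin : ∀ m, (Function.support fun n => p (mk 𝒜 n m)).Finite := fun m => by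
    refine (Set.finite_Icc (-B) B).subset fun n hn => ?_
    by_contra h
    refine hn (hzero n m ?_)
    rw [Set.mem_Icc, ← abs_le] at h
    exact not_le.mp h
  let v₀ : N →+ K := AddMonoidHom.mk' (fun m => ∑ᶠ n, p (mk 𝒜 n m)) fun x y => by
    simp_rw [map_add]
    exact finsum_add_distrib (hfin x) (hfin y)
  refine ⟨{ toFun := v₀, map_add' := map_add v₀, map_smul' := fun s m => ?_ }, fun n m => ?_⟩
  · obtain ⟨r, rfl⟩ := op_surjective s
    rw [RingHom.id_apply]
    induction r using DirectSum.Decomposition.inductionOn 𝒜 with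
    | zero => simp
    | add a b ha hb => rw [op_add, add_smul, map_add, ha, hb, add_smul]
    | @homogeneous j a =>
      change ∑ᶠ n, p (mk 𝒜 n (op (a : R) • m)) = op (a : R) • ∑ᶠ n, p (mk 𝒜 n m)
      rw [smul_finsum' _ (hfin m), ← finsum_comp_equiv (Equiv.addRight j)]
      refine finsum_congr fun n => ?_
      rw [Equiv.coe_addRight, ← op_smul_mk a.2, map_smul]
  · change 𝓚.proj n (∑ᶠ k, p (mk 𝒜 k m)) = _
    rw [AddMonoidHom.map_finsum _ (hfin m), finsum_eq_single _ n]
    · rw [hproj, if_pos rfl]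
    · intro k hk
      rw [hproj, if_neg hk]

theorem exists_graded_summand (hart : IsArtinianRing Rᵐᵒᵖ) (hbasic : IsBasic R)
    [Module.Finite Rᵐᵒᵖ N] [Nontrivial N]
    (hN : HasFiniteType Rᵐᵒᵖ (PruferQuotient 𝒜 N)) :
    ∃ (K : Type v) (_ : AddCommGroup K) (_ : Module Rᵐᵒᵖ K) (u : K →ₗ[Rᵐᵒᵖ] N)
      (w : N →ₗ[Rᵐᵒᵖ] K), Nontrivial K ∧ Nonempty (Grading 𝒜 K) ∧ ∀ x, w (u x) = x := by
  obtain ⟨L, hL0, hL⟩ := exists_bound 𝒜 hart hbasic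
  obtain ⟨X, _, _, hX, ι, s, t, hts⟩ := hN.exists_retraction
  obtain ⟨ℓ, hℓ⟩ := ENat.ne_top_iff_exists.mp (Module.length_ne_top_iff.mpr hX)
  obtain ⟨K, _, _, 𝓚, ⟨i, p, hi, hp, hpi⟩, hind, hK, hn⟩ :=
    -- The support of `K` reaches at most `2 * L * (ℓ + 1)` below `n`, so this choice keeps it in
    -- degrees at least `2 * L`, as the lift to `pN` requires.
    exists_isRetract_pruferGrading hart hbasic hX s t hts hL (n := 2 * L + 2 * L * (ℓ + 1)) (by
      have : 0 ≤ 2 * L * ((ℓ : ℤ) + 1) := by positivity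
      omega)
  obtain ⟨hKn, hKa⟩ := isFiniteLength_iff_isNoetherian_isArtinian.mp hK
  have hKnt : Nontrivial K := by
    obtain ⟨y, hy⟩ := hn
    exact ⟨_, _, hy⟩
  have hlen : Module.length Rᵐᵒᵖ K ≤ ℓ := by
    rw [hℓ]
    exact hind.length_le hart hbasic hK (s ∘ₗ i) (p ∘ₗ t) fun x => by simp [hts, hpi]
  have hlow : ∀ n < 2 * L, ∀ x, 𝓚.proj n x = 0 := fun n hn' x =>
    hind.proj_eq_zero_of_length_le hL hL0 hn hlen (by omega) x
  obtain ⟨B, -, hB⟩ := 𝓚.exists_proj_eq_zero hart hbasic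
  obtain ⟨g, hg⟩ := exists_lift hL0 hL 𝓚 hlow hi
  obtain ⟨v, hv⟩ := exists_sum_mk 𝓚 hB hp
  let u : K →ₗ[Rᵐᵒᵖ] N := counit 𝒜 N ∘ₗ g ∘ₗ 𝓚.coact
  -- On `x` of degree `n`, `u x` represents `i x` in degree `n`, and the degree `n` part of `v (u
  -- x)` is `p (i x) = x`.
  have hpart : 𝓚.part 𝓚 0 (v ∘ₗ u) = LinearMap.id := by
    ext x
    induction x using 𝓚.induction_on with
    | zero => simp
    | add x y hx hy => rw [map_add, map_add, hx, hy]
    | homogeneous n x hx =>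
      obtain ⟨m, hm1, hm2⟩ := hg n x
      have hux : u x = m := by
        have : 𝓚.coact x = e 𝒜 n x := by rw [← hx, 𝓚.coact_proj]
        simp [u, this, hm1]
      rw [𝓚.part_of_proj_eq 𝓚 _ hx, add_zero, LinearMap.comp_apply, hux, hv, hm2, hx, hpi]
      rfl
  have hbij := hind.bijective_of_part_zero hB (f := v ∘ₗ u) (by
    rw [hpart]; exact Function.bijective_id)
  refine ⟨K, _, _, u, (LinearEquiv.ofBijective _ hbij).symm.toLinearMap ∘ₗ v, hKnt, ⟨𝓚⟩,
    fun x => ?_⟩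
  exact (LinearEquiv.ofBijective (v ∘ₗ u) hbij).symm_apply_apply x

section Functoriality

variable {N' : Type v} [AddCommGroup N'] [Module Rᵐᵒᵖ N']

/-- The map `P_N → P_N'` induced by a linear map. -/
noncomputable def pruferMap (f : N →ₗ[Rᵐᵒᵖ] N') :
    PruferQuotient 𝒜 N →ₗ[Rᵐᵒᵖ] PruferQuotient 𝒜 N' :=
  liftP ((negativePart 𝒜 N').mkQ ∘ₗ map f) fun n hn m => by
    rw [LinearMap.comp_apply, map_e, mkQ_e, mk_of_neg hn]

theorem pruferMap_mk (f : N →ₗ[Rᵐᵒᵖ] N') (n : ℤ) (m : N) :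
    pruferMap f (mk 𝒜 n m) = mk 𝒜 n (f m) := by
  rw [pruferMap, liftP_mk, LinearMap.comp_apply, map_e, mkQ_e]

theorem hasFiniteType_pruferQuotient_of_retract (i : N' →ₗ[Rᵐᵒᵖ] N) (p : N →ₗ[Rᵐᵒᵖ] N')
    (hpi : ∀ x, p (i x) = x) (h : HasFiniteType Rᵐᵒᵖ (PruferQuotient 𝒜 N)) :
    HasFiniteType Rᵐᵒᵖ (PruferQuotient 𝒜 N') :=
  h.of_retract (pruferMap i) (pruferMap p) fun x => by
    induction x using PruferQuotient.induction_on with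
    | zero => simp
    | add x y hx hy => rw [map_add, map_add, hx, hy]
    | mk n m => rw [pruferMap_mk, pruferMap_mk, hpi]

end Functoriality

end Summand

/-- Induction on the length of `N`: split off a nonzero gradable summand `K`. By functoriality `P`
of the complement is a retract of `P_N`, so the complement is gradable, and `N` is isomorphic to the
product of the two. -/
theorem nonempty_grading_of_hasFiniteType (hart : IsArtinianRing Rᵐᵒᵖ) (hbasic : IsBasic R)
    (N : Type v) [AddCommGroup N] [Module Rᵐᵒᵖ N] [Module.Finite Rᵐᵒᵖ N]
    (hN : HasFiniteType Rᵐᵒᵖ (PruferQuotient 𝒜 N)) : Nonempty (Grading 𝒜 N) := by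
  obtain ⟨ℓ, hℓ⟩ := ENat.ne_top_iff_exists.mp (Module.length_ne_top (R := Rᵐᵒᵖ) (M := N))
  induction ℓ using Nat.strong_induction_on generalizing N with
  | _ ℓ ih =>
    rcases subsingleton_or_nontrivial N with hsub | hnt
    · exact ⟨{ coact := 0
               counit_coact := fun x => Subsingleton.elim _ _
               coact_coeff := fun n x => by simp }⟩
    obtain ⟨K, _, _, u, w, hK, ⟨𝓚⟩, hwu⟩ := exists_graded_summand hart hbasic hN
    let N' := LinearMap.ker w
    have hmem : ∀ x, x - u (w x) ∈ N' := fun x => by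
      rw [LinearMap.mem_ker, map_sub, hwu, sub_self]
    let p : N →ₗ[Rᵐᵒᵖ] N' := (LinearMap.id - u ∘ₗ w).codRestrict N' hmem
    have hp : ∀ x : N', p x = x := fun x => Subtype.ext (by
      have : w x = 0 := x.2
      simp [p, this])
    have hN'top : N' ≠ ⊤ := by
      intro h
      obtain ⟨x, hx⟩ := exists_ne (0 : K)
      have h1 : u x ∈ N' := h ▸ Submodule.mem_top
      exact hx (by rw [← hwu x]; exact h1)
    obtain ⟨ℓ', hℓ'⟩ := ENat.ne_top_iff_exists.mp (Module.length_ne_top (R := Rᵐᵒᵖ) (M := N'))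
    have hlt := Submodule.length_lt hN'top
    change Module.length Rᵐᵒᵖ N' < _ at hlt
    rw [← hℓ, ← hℓ'] at hlt
    obtain ⟨𝓝⟩ := ih ℓ' (by exact_mod_cast hlt) N'
      (hasFiniteType_pruferQuotient_of_retract N'.subtype p hp hN) hℓ'
    have h1 : ∀ x, (u.coprod N'.subtype) ((w.prod p) x) = x := fun x => by simp [p]
    have h2 : (w.prod p) ∘ₗ (u.coprod N'.subtype) = LinearMap.id := by
      refine LinearMap.ext fun x => Prod.ext ?_ ?_
      · have : w x.2 = 0 := x.2.2
        simp [hwu, this]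
      · have : w x.2 = 0 := x.2.2
        apply Subtype.ext
        simp [p, hwu, this]
    exact ⟨(𝓚.prod 𝓝).ofRetract (w.prod p) (u.coprod N'.subtype) h1 fun n x => by simp [h2]⟩

end GradedRight

theorem mainTheorem7 {R : Type u} [Ring R] (𝒜 : ℤ → AddSubgroup R) [GradedRing 𝒜]
    (hart : IsArtinianRing Rᵐᵒᵖ) (hbasic : GradedRight.IsBasic R)
    (N : Type v) [AddCommGroup N] [Module Rᵐᵒᵖ N] [Module.Finite Rᵐᵒᵖ N] :
    (Nontrivial N → GradedRight.IsPruferModule Rᵐᵒᵖ (GradedRight.PruferQuotient 𝒜 N)) ∧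
    (GradedRight.HasFiniteType Rᵐᵒᵖ (GradedRight.PruferQuotient 𝒜 N) ↔
      GradedRight.IsGradable 𝒜 N) := by
  refine ⟨fun _ => GradedRight.isPruferModule_pruferQuotient hart hbasic, fun h => ?_, fun h => ?_⟩
  · exact GradedRight.isGradable_iff_nonempty_grading.mpr
      (GradedRight.nonempty_grading_of_hasFiniteType hart hbasic N h)
  · obtain ⟨𝓖⟩ := GradedRight.isGradable_iff_nonempty_grading.mp h
    exact GradedRight.hasFiniteType_pruferQuotient 𝓖 hart hbasic
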